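/- Let $\alpha>-1/2$, let $\mathbb R^+=[0,\infty)$, let $d\mu_\alpha(x)=(2\pi)^{\alpha+1}x^{2\alpha+1}\,dx$ on $\mathbb R^+$, and let $L^p_\alpha=L^p(\mathbb R^+,\mu_\alpha)$ (complex-valued functions). Put $$j_\alpha(x)=\frac1{2^\alpha}\sum_{n=0}^\infty\frac{(-1)^n}{n!\,\Gamma(n+\alpha+1)}\Big(\frac x2\Big)^{2n},$$ and let $\mathcal F_\alpha$ be the Fourier--Bessel transform on $L^2_\alpha$, that is, the unique linear isometry of $L^2_\alpha$ into itself with $$\mathcal F_\alpha(f)(y)=\int_0^\infty f(x)\,j_\alpha(2\pi xy)\,d\mu_\alpha(x)\quad\text{for almost every } y,\qquad f\in L^1_\alpha\cap L^2_\alpha$$ (part of the assertion is that this isometry exists). Let $S,\Sigma\subset\mathbb R^+$ be measurable sets. Assume that either 1. the Lebesgue measures of $S$ and $\Sigma$ satisfy $0<|S|<\infty$ and $0<|\Sigma|<\infty$, or 2. $\mu_\alpha(S)<\infty$ and $\mu_\alpha(\Sigma)<\infty$. Then $(S,\Sigma)$ is a strong annihilating pair for $\mathcal F_\alpha$: there is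 a constant $C=C_\alpha(S,\Sigma)$ such that for all $f\in L^2_\alpha$ $$\|f\|_{L^2_\alpha}\le C\Big(\|f\|_{L^2_\alpha(\mathbb R^+\setminus S)}+\|\mathcal F_\alpha(f)\|_{L^2_\alpha(\mathbb R^+\setminus\Sigma)}\Big).$$ -/

import Mathlib

open MeasureTheory

noncomputable section

/-- The normalized Bessel function
`j_α(x) = J_α(x) / x^α = 2^{-α} ∑ₙ (-1)ⁿ / (n! Γ(n + α + 1)) (x / 2)^{2n}`. -/
def besselj (α x : ℝ) : ℝ :=
  (1 / (2 : ℝ) ^ α) *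
    ∑' n : ℕ, ((-1 : ℝ) ^ n / ((n.factorial : ℝ) * Real.Gamma ((n : ℝ) + α + 1))) *
      (x / 2) ^ (2 * n)

/-- The measure `dμ_α(x) = (2π)^{α+1} x^{2α+1} dx` on `ℝ⁺`, regarded as a measure on `ℝ`
that is carried by the half-line. -/
def besselMeasure (α : ℝ) : Measure ℝ :=
  (volume.restrict (Set.Ici (0 : ℝ))).withDensity
    (fun x => ENNReal.ofReal ((2 * Real.pi) ^ (α + 1) * x ^ (2 * α + 1)))

/-- The Hilbert space `L²_α(ℝ⁺)` of complex-valued functions. -/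
abbrev L2Bessel (α : ℝ) : Type := Lp ℂ 2 (besselMeasure α)

/-- The integral `∫₀^∞ f(x) j_α(2πxy) dμ_α(x)`, i.e. the Fourier–Bessel transform of
`f ∈ L¹_α(ℝ⁺)` at `y`. -/
def fourierBessel (α : ℝ) (f : ℝ → ℂ) (y : ℝ) : ℂ :=
  ∫ x, f x * (besselj α (2 * Real.pi * x * y) : ℂ) ∂(besselMeasure α)

/-- `F` is the extension of the Fourier–Bessel transform to an isometry of `L²_α(ℝ⁺)`: it is
given by the integral on `L¹_α ∩ L²_α`. As this subspace is dense, there is at most one such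
`F`; see `IsFourierBesselL2.unique`. -/
def IsFourierBesselL2 (α : ℝ) (F : L2Bessel α →ₗᵢ[ℂ] L2Bessel α) : Prop :=
  ∀ f : L2Bessel α, Integrable f (besselMeasure α) →
    F f =ᵐ[besselMeasure α] fourierBessel α f

theorem IsFourierBesselL2.unique {α : ℝ} {F G : L2Bessel α →ₗᵢ[ℂ] L2Bessel α}
    (hF : IsFourierBesselL2 α F) (hG : IsFourierBesselL2 α G) : F = G := by
  have hd : DenseRange ((↑) : Lp.simpleFunc ℂ 2 (besselMeasure α) → L2Bessel α) :=
    Lp.simpleFunc.denseRange (by simp)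
  have h : (F : L2Bessel α → L2Bessel α) = G := by
    refine hd.equalizer F.continuous G.continuous (funext fun s => ?_)
    have hs : Integrable (s : L2Bessel α) (besselMeasure α) := by
      have h1 : MemLp (Lp.simpleFunc.toSimpleFunc s) 2 (besselMeasure α) :=
        Lp.simpleFunc.memLp s
      have h2 : Integrable (Lp.simpleFunc.toSimpleFunc s) (besselMeasure α) :=
        (SimpleFunc.memLp_iff_integrable (by simp) (by simp)).1 h1
      exact h2.congr (Lp.simpleFunc.toSimpleFunc_eq_toFun s)
    exact Lp.ext ((hF _ hs).trans (hG _ hs).symm)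
  exact DFunLike.coe_injective h

/-- The norm of `L²_α(A)` applied to (the restriction to `A` of) `f ∈ L²_α(ℝ⁺)`. -/
def normOn (α : ℝ) (A : Set ℝ) (f : L2Bessel α) : ℝ :=
  (eLpNorm f 2 ((besselMeasure α).restrict A)).toReal

/-- `(S, T)` is a strong annihilating pair for the Fourier–Bessel transform: there is a constant
`C`, which depends on `α`, `S` and `T` only, with
`‖f‖ ≤ C (‖f‖_{L²_α(ℝ⁺ ∖ S)} + ‖F f‖_{L²_α(ℝ⁺ ∖ T)})` for all `f ∈ L²_α(ℝ⁺)`, where `F` is the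
Fourier–Bessel transform on `L²_α(ℝ⁺)`. The existence of `F` is part of the assertion. -/
def IsStrongAnnihilatingPair (α : ℝ) (S T : Set ℝ) : Prop :=
  ∃ F : L2Bessel α →ₗᵢ[ℂ] L2Bessel α, IsFourierBesselL2 α F ∧
    ∃ C : ℝ, ∀ f : L2Bessel α,
      ‖f‖ ≤ C * (normOn α (Set.Ici 0 \ S) f + normOn α (Set.Ici 0 \ T) (F f))

end

open Filter Topology

/-!
On Gaussians `x ↦ exp (-π s x²)` the Fourier–Bessel transform is explicit, and it preserves inner
products of these; as their span is dense in `L²_α`, it extends to an isometry `F`.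

An energy estimate for the differential equation of `√t J_α(t)` shows that this function is bounded
on `[1, ∞)`, so `|j_α(t)| ≤ C t ^ (-(α + 1/2))`. Hence restricting to a set `S` of finite
Lebesgue measure, applying `F` and restricting to a set `T` of finite Lebesgue measure gives a
Hilbert–Schmidt, hence compact, operator. By compactness, the pair is strongly annihilating as soon
as no `f ≠ 0` vanishes outside `S` while `F f` vanishes outside `T`, and in any case such `f` form a
finite-dimensional space.

If there were such an `f`, its dilates by factors `cₙ < 1` tending rapidly to `1` would vanish, with
their transforms, outside slightly larger sets, still of finite measure. The dilates of index at
least `N` lie in spaces that decrease with `N`, so by finite dimension one dilate lies in all of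
them. By the Borel–Cantelli lemma it vanishes outside the support of `f`, which is impossible since
the dilate has a support of larger measure.
-/

/-! ### The Bessel series -/

/-- The coefficients of `besselSeries`. -/
noncomputable def besselCoeff (ν : ℝ) (n : ℕ) : ℝ :=
  (-1 : ℝ) ^ n / ((n.factorial : ℝ) * Real.Gamma ((n : ℝ) + ν + 1))

/-- The entire function `z ↦ ∑ (-1)ⁿ zⁿ / (n! Γ(n + ν + 1))`; its values at `z = (x / 2)²` are
those of the normalized Bessel function. -/
noncomputable def besselSeries (ν z : ℝ) : ℝ := ∑' n : ℕ, besselCoeff ν n * z ^ n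

theorem besselj_eq_besselSeries (α x : ℝ) :
    besselj α x = (1 / (2 : ℝ) ^ α) * besselSeries α ((x / 2) ^ 2) := by
  simp only [besselj, besselSeries, besselCoeff, pow_mul]

theorem summable_mul_pow_of_abs_le_div_factorial {c : ℕ → ℝ} {K : ℝ}
    (hc : ∀ n, |c n| ≤ K / n.factorial) (z : ℝ) : Summable fun n => c n * z ^ n := by
  refine .of_norm_bounded ((Real.summable_pow_div_factorial |z|).mul_left K) fun n => ?_
  rw [Real.norm_eq_abs, abs_mul, abs_pow, mul_div_left_comm, mul_comm (|z| ^ n)]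
  gcongr
  exact hc n

theorem hasDerivAt_tsum_mul_pow {c : ℕ → ℝ} {K : ℝ} (hc : ∀ n, |c n| ≤ K / n.factorial) (z : ℝ) :
    HasDerivAt (fun z => ∑' n, c n * z ^ n) (∑' n : ℕ, c (n + 1) * (n + 1) * z ^ n) z := by
  set R := |z| + 1
  have hR : Summable fun n : ℕ => K * (R ^ (n - 1) / (n - 1).factorial) := by
    refine Summable.mul_left K ((summable_nat_add_iff 1).1 ?_)
    simpa only [Nat.add_sub_cancel] using Real.summable_pow_div_factorial R
  have hsucc (n : ℕ) : |c (n + 1) * (n + 1)| ≤ K / n.factorial := by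
    have := hc (n + 1)
    rw [Nat.factorial_succ, Nat.cast_mul, mul_comm (n + 1 : ℕ).cast, ← div_div,
      le_div_iff₀ (by positivity)] at this
    rwa [abs_mul, abs_of_nonneg (a := (n : ℝ) + 1) (by positivity), ← Nat.cast_succ]
  have hbound (n : ℕ) (y : ℝ) (hy : y ∈ Metric.ball (0 : ℝ) R) :
      ‖c n * (n * y ^ (n - 1))‖ ≤ K * (R ^ (n - 1) / (n - 1).factorial) := by
    have hy : |y| ≤ R := (mem_ball_zero_iff.1 hy).le
    cases n with
    | zero =>
      have hK : 0 ≤ K := by simpa using (abs_nonneg _).trans (hc 0)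
      simpa using hK
    | succ n =>
      rw [Nat.add_sub_cancel, ← mul_assoc, norm_mul, norm_pow, mul_div_left_comm,
        mul_comm (R ^ n)]
      gcongr
      · exact (abs_nonneg _).trans (hsucc n)
      · simpa using hsucc n
      · simpa using hy
  have hz : z ∈ Metric.ball (0 : ℝ) R := mem_ball_zero_iff.2 (lt_add_one |z|)
  have hderiv := hasDerivAt_tsum_of_isPreconnected hR Metric.isOpen_ball
    (convex_ball _ _).isPreconnected (fun n y _ => (hasDerivAt_pow n y).const_mul (c n)) hbound
    hz (summable_mul_pow_of_abs_le_div_factorial hc z) hz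
  refine hderiv.congr_deriv ?_
  have hs := summable_mul_pow_of_abs_le_div_factorial hsucc z
  rw [tsum_eq_zero_add' (by simpa [mul_assoc] using hs)]
  simp [mul_assoc]

theorem exists_pos_le_Gamma_natCast_add {ν : ℝ} (hν : -1 < ν) :
    ∃ m : ℝ, 0 < m ∧ ∀ n : ℕ, m ≤ Real.Gamma (n + ν + 1) := by
  refine ⟨min (Real.Gamma (ν + 1)) (Real.Gamma (ν + 2)), lt_min
    (Real.Gamma_pos_of_pos (by linarith)) (Real.Gamma_pos_of_pos (by linarith)), fun n => ?_⟩
  match n with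
  | 0 => simp
  | n + 1 =>
    induction n with
    | zero => exact (min_le_right _ _).trans_eq (by congr 1; push_cast; ring)
    | succ n ih =>
      have hone : (1 : ℝ) ≤ n + 1 + ν + 1 := by linarith [n.cast_nonneg (α := ℝ)]
      push_cast at ih ⊢
      rw [show (n : ℝ) + 1 + 1 + ν + 1 = (n + 1 + ν + 1) + 1 by ring,
        Real.Gamma_add_one (s := n + 1 + ν + 1) (one_pos.trans_le hone).ne']
      exact ih.trans (le_mul_of_one_le_left
        (Real.Gamma_pos_of_pos (one_pos.trans_le hone)).le hone)

theorem exists_abs_besselCoeff_le {ν : ℝ} (hν : -1 < ν) :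
    ∃ K : ℝ, ∀ n : ℕ, |besselCoeff ν n| ≤ K / n.factorial := by
  obtain ⟨m, hm, hle⟩ := exists_pos_le_Gamma_natCast_add hν
  refine ⟨1 / m, fun n => ?_⟩
  rw [besselCoeff, abs_div, abs_pow, abs_neg, abs_one, one_pow,
    abs_of_pos (mul_pos (by positivity) (hm.trans_le (hle n))), div_div, mul_comm m]
  gcongr
  exact hle n

theorem summable_besselCoeff_mul_pow {ν : ℝ} (hν : -1 < ν) (z : ℝ) :
    Summable fun n : ℕ => besselCoeff ν n * z ^ n :=
  have ⟨_, hK⟩ := exists_abs_besselCoeff_le hν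
  summable_mul_pow_of_abs_le_div_factorial hK z

theorem besselCoeff_succ_mul (ν : ℝ) (n : ℕ) :
    besselCoeff ν (n + 1) * (n + 1) = -besselCoeff (ν + 1) n := by
  simp only [besselCoeff, Nat.factorial_succ]
  push_cast
  rw [show (n : ℝ) + 1 + ν + 1 = n + (ν + 1) + 1 by ring]
  field_simp
  ring

theorem besselCoeff_eq_mul {ν : ℝ} (hν : -1 < ν) (n : ℕ) :
    besselCoeff ν n = (n + ν + 1) * besselCoeff (ν + 1) n := by
  have hpos : 0 < (n : ℝ) + ν + 1 := by linarith [n.cast_nonneg (α := ℝ)]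
  have hG := (Real.Gamma_pos_of_pos hpos).ne'
  rw [besselCoeff, besselCoeff, show (n : ℝ) + (ν + 1) + 1 = (n + ν + 1) + 1 by ring,
    Real.Gamma_add_one hpos.ne']
  field_simp

theorem hasDerivAt_besselSeries {ν : ℝ} (hν : -1 < ν) (z : ℝ) :
    HasDerivAt (besselSeries ν) (-besselSeries (ν + 1) z) z := by
  obtain ⟨K, hK⟩ := exists_abs_besselCoeff_le hν
  refine (hasDerivAt_tsum_mul_pow hK z).congr_deriv ?_
  simp only [besselCoeff_succ_mul, neg_mul, tsum_neg, besselSeries]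

theorem besselSeries_recurrence {ν : ℝ} (hν : -1 < ν) (z : ℝ) :
    (ν + 1) * besselSeries (ν + 1) z - z * besselSeries (ν + 2) z = besselSeries ν z := by
  have h0 := summable_besselCoeff_mul_pow hν z
  have h1 := summable_besselCoeff_mul_pow (ν := ν + 1) (by linarith) z
  have h2 := summable_besselCoeff_mul_pow (ν := ν + 2) (by linarith) z
  have hterm (n : ℕ) : (ν + 1) * (besselCoeff (ν + 1) (n + 1) * z ^ (n + 1))
      - z * (besselCoeff (ν + 2) n * z ^ n) = besselCoeff ν (n + 1) * z ^ (n + 1) := by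
    have hsucc := besselCoeff_succ_mul (ν + 1) n
    rw [show ν + 1 + 1 = ν + 2 by ring] at hsucc
    rw [besselCoeff_eq_mul hν (n + 1), ← neg_eq_iff_eq_neg.2 hsucc]
    push_cast
    ring
  simp only [besselSeries]
  rw [h0.tsum_eq_zero_add, h1.tsum_eq_zero_add, mul_add, ← tsum_mul_left, ← tsum_mul_left,
    add_sub_assoc, ← (((summable_nat_add_iff 1).2 h1).mul_left (ν + 1)).tsum_sub (h2.mul_left z),
    besselCoeff_eq_mul hν 0, tsum_congr hterm]
  simp

theorem continuous_besselj {α : ℝ} (hα : -1 < α) : Continuous (besselj α) := by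
  have hs : Continuous (besselSeries α) :=
    continuous_iff_continuousAt.2 fun z => (hasDerivAt_besselSeries hα z).continuousAt
  rw [funext (besselj_eq_besselSeries α)]
  fun_prop

/-! ### Decay of the Bessel function -/

theorem antitoneOn_energy {s : Set ℝ} (hs : Convex ℝ s) {u v q Q Q' : ℝ → ℝ}
    (hu : ∀ x ∈ s, HasDerivAt u (v x) x) (hv : ∀ x ∈ s, HasDerivAt v ((q x - 1) * u x) x)
    (hQ : ∀ x ∈ s, HasDerivAt Q (Q' x) x) (hq : ∀ x ∈ s, |q x| ≤ Q' x) :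
    AntitoneOn (fun x => (u x ^ 2 + v x ^ 2) * Real.exp (-Q x)) s := by
  have hderiv (x : ℝ) (hx : x ∈ s) :
      HasDerivAt (fun x => (u x ^ 2 + v x ^ 2) * Real.exp (-Q x))
        ((2 * q x * u x * v x - Q' x * (u x ^ 2 + v x ^ 2)) * Real.exp (-Q x)) x := by
    refine ((((hu x hx).pow 2).add ((hv x hx).pow 2)).mul (hQ x hx).neg.exp).congr_deriv ?_
    simp only [Pi.add_apply, Pi.pow_apply, Pi.neg_apply]
    push_cast
    ring
  refine antitoneOn_of_hasDerivWithinAt_nonpos hs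
    (fun x hx => (hderiv x hx).continuousAt.continuousWithinAt)
    (fun x hx => (hderiv x (interior_subset hx)).hasDerivWithinAt) fun x hx =>
      mul_nonpos_of_nonpos_of_nonneg (sub_nonpos.2 ?_) (Real.exp_nonneg _)
  calc 2 * q x * u x * v x ≤ |q x| * (2 * |u x| * |v x|) := by
        refine (le_abs_self _).trans_eq ?_
        rw [abs_mul, abs_mul, abs_mul, abs_two]
        ring
    _ ≤ Q' x * (u x ^ 2 + v x ^ 2) := by
        rw [← sq_abs (u x), ← sq_abs (v x)]
        exact mul_le_mul (hq x (interior_subset hx)) (two_mul_le_add_sq _ _) (by positivity)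
          ((abs_nonneg _).trans (hq x (interior_subset hx)))

theorem hasDerivAt_besselSeries_sq {ν : ℝ} (hν : -1 < ν) (x : ℝ) :
    HasDerivAt (fun x => besselSeries ν ((x / 2) ^ 2))
      (-(x / 2) * besselSeries (ν + 1) ((x / 2) ^ 2)) x := by
  have hsq : HasDerivAt (fun x : ℝ => (x / 2) ^ 2) (x / 2) x := by
    refine (((hasDerivAt_id x).div_const 2).pow 2).congr_deriv ?_
    simp only [id]
    ring
  refine ((hasDerivAt_besselSeries hν ((x / 2) ^ 2)).comp x hsq).congr_deriv ?_
  ring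

/-- The function `√x J_α(x)`, up to a constant factor. -/
noncomputable def besselU (α x : ℝ) : ℝ := x ^ (α + 1 / 2) * besselSeries α ((x / 2) ^ 2)

/-- The derivative of `besselU`. -/
noncomputable def besselV (α x : ℝ) : ℝ :=
  (α + 1 / 2) * x ^ (α - 1 / 2) * besselSeries α ((x / 2) ^ 2)
    - x ^ (α + 1 / 2) * (x / 2) * besselSeries (α + 1) ((x / 2) ^ 2)

theorem hasDerivAt_besselU {α : ℝ} (hα : -1 < α) {x : ℝ} (hx : 0 < x) :
    HasDerivAt (besselU α) (besselV α x) x := by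
  refine ((Real.hasDerivAt_rpow_const (p := α + 1 / 2) (.inl hx.ne')).mul
    (hasDerivAt_besselSeries_sq hα x)).congr_deriv ?_
  rw [besselV, show α + 1 / 2 - 1 = α - 1 / 2 by ring]
  ring

theorem hasDerivAt_besselV {α : ℝ} (hα : -1 < α) {x : ℝ} (hx : 0 < x) :
    HasDerivAt (besselV α) (((α ^ 2 - 1 / 4) / x ^ 2 - 1) * besselU α x) x := by
  have hpow (p : ℝ) := Real.hasDerivAt_rpow_const (x := x) (p := p) (.inl hx.ne')
  have hsucc := hasDerivAt_besselSeries_sq (ν := α + 1) (by linarith) x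
  rw [show α + 1 + 1 = α + 2 by ring] at hsucc
  refine ((((hpow _).const_mul (α + 1 / 2)).mul (hasDerivAt_besselSeries_sq hα x)).sub
    (((hpow _).mul ((hasDerivAt_id x).div_const 2)).mul hsucc)).congr_deriv ?_
  have hsub : x ^ (α - 1 / 2) = x ^ (α + 1 / 2) / x := by
    rw [← Real.rpow_sub_one hx.ne']
    ring_nf
  have hsub' : x ^ (α - 1 / 2 - 1) = x ^ (α + 1 / 2) / x ^ 2 := by
    rw [Real.rpow_sub_one hx.ne', hsub, div_div, sq]
  simp only [besselU, id, Pi.mul_apply]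
  rw [show α + 1 / 2 - 1 = α - 1 / 2 by ring, hsub, hsub', ← besselSeries_recurrence hα]
  field_simp
  ring

theorem exists_abs_besselU_le {α : ℝ} (hα : -1 < α) :
    ∃ C : ℝ, ∀ x : ℝ, 1 ≤ x → |besselU α x| ≤ C := by
  set c := |α ^ 2 - 1 / 4|
  have hpos {x : ℝ} (hx : x ∈ Set.Ici (1 : ℝ)) : 0 < x := one_pos.trans_le hx
  have hQ (x : ℝ) (hx : x ∈ Set.Ici (1 : ℝ)) :
      HasDerivAt (fun x => -(c / x)) (c / x ^ 2) x := by
    refine ((hasDerivAt_inv (hpos hx).ne').const_mul (-c)).congr_deriv (by ring)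
      |>.congr_of_eventuallyEq (.of_forall fun y => ?_)
    simp only [div_eq_mul_inv, neg_mul]
  have hanti := antitoneOn_energy (convex_Ici 1) (fun x hx => hasDerivAt_besselU hα (hpos hx))
    (fun x hx => hasDerivAt_besselV hα (hpos hx)) hQ fun x _ => by
      rw [abs_div, abs_of_nonneg (sq_nonneg x)]
  simp only [neg_neg] at hanti
  refine ⟨√((besselU α 1 ^ 2 + besselV α 1 ^ 2) * Real.exp (c / 1)), fun x hx =>
    Real.abs_le_sqrt ?_⟩
  have hexp : 1 ≤ Real.exp (c / x) := Real.one_le_exp (div_nonneg (abs_nonneg _) (hpos hx).le)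
  calc besselU α x ^ 2 ≤ besselU α x ^ 2 + besselV α x ^ 2 := by
        linarith [sq_nonneg (besselV α x)]
    _ ≤ (besselU α x ^ 2 + besselV α x ^ 2) * Real.exp (c / x) :=
        le_mul_of_one_le_right (by positivity) hexp
    _ ≤ _ := hanti Set.self_mem_Ici hx hx

theorem exists_abs_besselj_le_mul_rpow_neg {α : ℝ} (hα : -1 / 2 ≤ α) :
    ∃ C : ℝ, 0 ≤ C ∧ ∀ x : ℝ, 0 < x → ∀ γ : ℝ, 0 ≤ γ → γ ≤ α + 1 / 2 →
      |besselj α x| ≤ C * x ^ (-γ) := by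
  have hα1 : -1 < α := by linarith
  obtain ⟨C₁, hC₁⟩ := isCompact_Icc.exists_bound_of_continuousOn (s := Set.Icc 0 1)
    (continuous_besselj hα1).continuousOn
  obtain ⟨C₂, hC₂⟩ := exists_abs_besselU_le hα1
  refine ⟨max C₁ (1 / (2 : ℝ) ^ α * C₂), le_max_of_le_left
    ((norm_nonneg _).trans (hC₁ 0 (by simp))), fun x hx γ hγ₀ hγ => ?_⟩
  have hxγ : 0 < x ^ γ := Real.rpow_pos_of_pos hx γ
  rw [Real.rpow_neg hx.le, ← div_eq_mul_inv, le_div_iff₀ hxγ]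
  obtain hx1 | hx1 := le_total x 1
  · calc |besselj α x| * x ^ γ ≤ |besselj α x| * 1 := by
          gcongr
          exact Real.rpow_le_one hx.le hx1 hγ₀
      _ ≤ _ := by
          rw [mul_one]
          exact le_max_of_le_left (hC₁ x ⟨hx.le, hx1⟩)
  · calc |besselj α x| * x ^ γ ≤ |besselj α x| * x ^ (α + 1 / 2) := by gcongr
      _ = 1 / (2 : ℝ) ^ α * |besselU α x| := by
          rw [besselj_eq_besselSeries, besselU, abs_mul, abs_mul, abs_of_pos (by positivity),
            abs_of_pos (Real.rpow_pos_of_pos hx _)]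
          ring
      _ ≤ _ := le_max_of_le_right (by gcongr; exact hC₂ x hx1)

/-! ### The measure -/

/-- The density of `besselMeasure`. -/
noncomputable def besselWeight (α x : ℝ) : ℝ := (2 * Real.pi) ^ (α + 1) * x ^ (2 * α + 1)

theorem measurable_besselWeight (α : ℝ) : Measurable (besselWeight α) := by
  unfold besselWeight
  fun_prop

theorem besselWeight_pos (α : ℝ) {x : ℝ} (hx : 0 < x) : 0 < besselWeight α x := by
  unfold besselWeight
  positivity

theorem besselWeight_mul (α : ℝ) {c x : ℝ} (hc : 0 < c) (hx : 0 < x) :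
    besselWeight α (c * x) = c ^ (2 * α + 1) * besselWeight α x := by
  rw [besselWeight, besselWeight, Real.mul_rpow hc.le hx.le, mul_left_comm]

theorem besselMeasure_eq_withDensity_Ioi (α : ℝ) :
    besselMeasure α = (volume.restrict (Set.Ioi 0)).withDensity
      (fun x => ENNReal.ofReal (besselWeight α x)) := by
  rw [besselMeasure, ← restrict_Ioi_eq_restrict_Ici]
  rfl

instance sigmaFinite_besselMeasure (α : ℝ) : SigmaFinite (besselMeasure α) := by
  rw [besselMeasure_eq_withDensity_Ioi]
  exact SigmaFinite.withDensity_ofReal _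

theorem ae_besselMeasure_iff (α : ℝ) {p : ℝ → Prop} :
    (∀ᵐ x ∂(besselMeasure α), p x) ↔ ∀ᵐ x : ℝ, 0 < x → p x := by
  rw [besselMeasure_eq_withDensity_Ioi,
    ae_withDensity_iff (measurable_besselWeight α).ennreal_ofReal,
    ae_restrict_iff' measurableSet_Ioi]
  refine eventually_congr (.of_forall fun x => forall_congr' fun hx => ?_)
  simp only [ne_eq, ENNReal.ofReal_eq_zero, not_le.2 (besselWeight_pos α hx),
    not_false_eq_true, true_imp_iff]

theorem ae_besselMeasure_pos (α : ℝ) : ∀ᵐ x ∂(besselMeasure α), 0 < x :=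
  (ae_besselMeasure_iff α).2 (.of_forall fun _ => id)

theorem lintegral_besselMeasure (α : ℝ) (g : ℝ → ENNReal) :
    ∫⁻ x, g x ∂(besselMeasure α) =
      ∫⁻ x in Set.Ioi 0, ENNReal.ofReal (besselWeight α x) * g x := by
  rw [besselMeasure_eq_withDensity_Ioi]
  exact lintegral_withDensity_eq_lintegral_mul_non_measurable _
    (measurable_besselWeight α).ennreal_ofReal (.of_forall fun _ => ENNReal.ofReal_lt_top) g

section Integral

variable {E : Type*} [NormedAddCommGroup E] [NormedSpace ℝ E]

theorem integrable_besselMeasure_iff (α : ℝ) {g : ℝ → E} :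
    Integrable g (besselMeasure α) ↔
      IntegrableOn (fun x => besselWeight α x • g x) (Set.Ioi 0) := by
  rw [besselMeasure_eq_withDensity_Ioi, integrable_withDensity_iff_integrable_smul'
    (measurable_besselWeight α).ennreal_ofReal (by simp), IntegrableOn]
  refine integrable_congr ?_
  filter_upwards [ae_restrict_mem measurableSet_Ioi] with x hx
  rw [ENNReal.toReal_ofReal (besselWeight_pos α hx).le]

theorem integral_besselMeasure (α : ℝ) (g : ℝ → E) :
    ∫ x, g x ∂(besselMeasure α) = ∫ x in Set.Ioi 0, besselWeight α x • g x := by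
  rw [besselMeasure_eq_withDensity_Ioi, integral_withDensity_eq_integral_toReal_smul₀
    (measurable_besselWeight α).ennreal_ofReal.aemeasurable (by simp)]
  refine integral_congr_ae ?_
  filter_upwards [ae_restrict_mem measurableSet_Ioi] with x hx
  rw [ENNReal.toReal_ofReal (besselWeight_pos α hx).le]

end Integral

theorem map_mul_left_besselMeasure (α : ℝ) {c : ℝ} (hc : 0 < c) :
    (besselMeasure α).map (c * ·) = ENNReal.ofReal (c ^ (-(2 * α + 2))) • besselMeasure α := by
  have hpow : c ^ (-(2 * α + 2)) = c ^ (-(2 * α + 1)) * |c⁻¹| := by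
    rw [abs_of_pos (inv_pos.2 hc), ← Real.rpow_neg_one, ← Real.rpow_add hc]
    ring_nf
  have hweight {x : ℝ} (hx : 0 < x) :
      besselWeight α x = c ^ (-(2 * α + 1)) * besselWeight α (c * x) := by
    rw [besselWeight_mul α hc hx, ← mul_assoc, ← Real.rpow_add hc, neg_add_cancel,
      Real.rpow_zero, one_mul]
  refine Measure.ext fun A hA => ?_
  set g : ℝ → ENNReal := (Set.Ioi 0).indicator fun x =>
    ENNReal.ofReal (besselWeight α x) * A.indicator 1 x
  have hg : Measurable g := (((measurable_besselWeight α).ennreal_ofReal).mul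
    (measurable_one.indicator hA)).indicator measurableSet_Ioi
  have hlhs : besselMeasure α ((c * ·) ⁻¹' A) =
      ∫⁻ x, ENNReal.ofReal (c ^ (-(2 * α + 1))) * g (c * x) := by
    rw [← lintegral_indicator_one (measurable_const_mul c hA), lintegral_besselMeasure,
      ← lintegral_indicator measurableSet_Ioi]
    refine lintegral_congr fun x => ?_
    by_cases hx : 0 < x
    · simp only [g, Set.indicator_of_mem (Set.mem_Ioi.2 hx),
        Set.indicator_of_mem (Set.mem_Ioi.2 (mul_pos hc hx))]
      rw [hweight hx, ENNReal.ofReal_mul (by positivity), mul_assoc]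
      rfl
    · simp [g, hx, mul_pos_iff_of_pos_left hc]
  rw [Measure.map_apply (measurable_const_mul c) hA, hlhs, Measure.smul_apply, smul_eq_mul,
    lintegral_const_mul _ (f := fun x => g (c * x)) (hg.comp (measurable_const_mul c)),
    ← lintegral_map hg (measurable_const_mul c), Real.map_volume_mul_left hc.ne',
    lintegral_smul_measure, smul_eq_mul, ← mul_assoc, ← ENNReal.ofReal_mul (by positivity),
    ← hpow, lintegral_indicator measurableSet_Ioi, ← lintegral_besselMeasure,
    lintegral_indicator_one hA]

/-! ### Gaussians -/

/-- The Gaussian `x ↦ exp (-π s x²)`. -/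
noncomputable def gauss (s x : ℝ) : ℝ := Real.exp (-(Real.pi * s) * x ^ 2)

theorem continuous_gauss (s : ℝ) : Continuous (gauss s) := by
  unfold gauss
  fun_prop

theorem gauss_pos (s x : ℝ) : 0 < gauss s x := Real.exp_pos _

theorem gauss_mul_gauss (s t x : ℝ) : gauss s x * gauss t x = gauss (s + t) x := by
  rw [gauss, gauss, gauss, ← Real.exp_add]
  ring_nf

theorem hasSum_gauss (s x : ℝ) :
    HasSum (fun n : ℕ => (-(Real.pi * s) * x ^ 2) ^ n / n.factorial) (gauss s x) := by
  rw [gauss, Real.exp_eq_exp_ℝ]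
  exact NormedSpace.expSeries_div_hasSum_exp _

theorem besselWeight_mul_rpow_mul_gauss (α s r : ℝ) {x : ℝ} (hx : 0 < x) :
    besselWeight α x * (x ^ r * gauss s x) = (2 * Real.pi) ^ (α + 1) *
      (x ^ (2 * α + 1 + r) * Real.exp (-(Real.pi * s) * x ^ (2 : ℝ))) := by
  rw [besselWeight, gauss, Real.rpow_add hx (2 * α + 1), Real.rpow_two]
  ring

theorem integrable_rpow_mul_gauss {α s r : ℝ} (hs : 0 < s) (hr : -(2 * α + 2) < r) :
    Integrable (fun x => x ^ r * gauss s x) (besselMeasure α) := by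
  rw [integrable_besselMeasure_iff]
  refine IntegrableOn.congr_fun ((integrableOn_rpow_mul_exp_neg_mul_rpow (p := 2)
    (s := 2 * α + 1 + r) (b := Real.pi * s) (by linarith) (by norm_num) (by positivity)).const_mul
      ((2 * Real.pi) ^ (α + 1))) (fun x hx => ?_) measurableSet_Ioi
  rw [smul_eq_mul, besselWeight_mul_rpow_mul_gauss α s r hx]

theorem integral_rpow_mul_gauss {α s r : ℝ} (hs : 0 < s) (hr : -(2 * α + 2) < r) :
    ∫ x, x ^ r * gauss s x ∂(besselMeasure α) =
      2 ^ α * s ^ (-(α + 1)) * (Real.pi * s) ^ (-(r / 2)) * Real.Gamma (r / 2 + α + 1) := by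
  rw [integral_besselMeasure, setIntegral_congr_fun measurableSet_Ioi fun x hx => by
      rw [smul_eq_mul, besselWeight_mul_rpow_mul_gauss α s r hx],
    integral_const_mul, integral_rpow_mul_exp_neg_mul_rpow (by norm_num) (by linarith)
      (by positivity), show (2 * α + 1 + r + 1) / 2 = r / 2 + α + 1 by ring,
    show -(2 * α + 1 + r + 1) / 2 = -(α + 1) + -(r / 2) by ring,
    Real.rpow_add (x := Real.pi * s) (by positivity), Real.mul_rpow zero_le_two Real.pi_nonneg,
    Real.mul_rpow (z := -(α + 1)) Real.pi_nonneg hs.le,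
    Real.rpow_neg Real.pi_nonneg, Real.rpow_add_one (x := 2) two_ne_zero]
  field_simp

section

variable {α s : ℝ} (hα : -1 < α) (hs : 0 < s)
include hα hs

theorem integrable_gauss : Integrable (gauss s) (besselMeasure α) := by
  simpa using integrable_rpow_mul_gauss (r := 0) hs (by linarith)

theorem integral_gauss :
    ∫ x, gauss s x ∂(besselMeasure α) = 2 ^ α * Real.Gamma (α + 1) * s ^ (-(α + 1)) := by
  have h := integral_rpow_mul_gauss (α := α) (r := 0) hs (by linarith)
  simp only [Real.rpow_zero, one_mul, zero_div, neg_zero, mul_one, zero_add] at h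
  rw [h, mul_right_comm]

theorem integrable_pow_mul_gauss (n : ℕ) :
    Integrable (fun x => x ^ n * gauss s x) (besselMeasure α) := by
  simpa using integrable_rpow_mul_gauss (r := n) hs (by linarith [n.cast_nonneg (α := ℝ)])

theorem integral_pow_two_mul_mul_gauss (n : ℕ) :
    ∫ x, x ^ (2 * n) * gauss s x ∂(besselMeasure α) =
      2 ^ α * s ^ (-(α + 1)) * (Real.pi * s)⁻¹ ^ n * Real.Gamma (n + α + 1) := by
  have h := integral_rpow_mul_gauss (α := α) (r := (2 * n : ℕ)) hs (by
    linarith [(2 * n).cast_nonneg (α := ℝ)])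
  simp only [Real.rpow_natCast] at h
  rw [h, Nat.cast_mul, Nat.cast_two, mul_div_cancel_left₀ _ two_ne_zero,
    Real.rpow_neg (x := Real.pi * s) (by positivity), Real.rpow_natCast, inv_pow]

theorem integral_gauss_mul_besselj (y : ℝ) :
    ∫ x, gauss s x * besselj α (2 * Real.pi * x * y) ∂(besselMeasure α) =
      s ^ (-(α + 1)) * gauss s⁻¹ y := by
  have hΓ (n : ℕ) : 0 < Real.Gamma (n + α + 1) :=
    Real.Gamma_pos_of_pos (by linarith [n.cast_nonneg (α := ℝ)])
  set a : ℕ → ℝ := fun n =>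
    (Real.pi * y) ^ (2 * n) / (2 ^ α * (n.factorial * Real.Gamma (n + α + 1)))
  set G : ℕ → ℝ → ℝ := fun n x => a n * (x ^ (2 * n) * gauss s x)
  have hG (n : ℕ) (x : ℝ) : 0 ≤ G n x :=
    mul_nonneg (div_nonneg ((even_two_mul n).pow_nonneg _) (mul_pos (by positivity)
      (mul_pos (by positivity) (hΓ n))).le)
      (mul_nonneg ((even_two_mul n).pow_nonneg _) (gauss_pos s x).le)
  have hGint (n : ℕ) : ∫ x, G n x ∂(besselMeasure α) =
      s ^ (-(α + 1)) * ((Real.pi * y ^ 2 / s) ^ n / n.factorial) := by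
    have := (hΓ n).ne'
    rw [integral_const_mul, integral_pow_two_mul_mul_gauss hα hs n,
      show Real.pi * y ^ 2 / s = (Real.pi * y) ^ 2 * (Real.pi * s)⁻¹ by field_simp, mul_pow,
      ← pow_mul]
    simp only [a]
    field_simp
  have hseries (x : ℝ) :
      gauss s x * besselj α (2 * Real.pi * x * y) = ∑' n, (-1) ^ n * G n x := by
    rw [besselj, ← mul_assoc, ← tsum_mul_left]
    refine tsum_congr fun n => ?_
    simp only [G, a]
    rw [show 2 * Real.pi * x * y / 2 = (Real.pi * y) * x by ring, mul_pow _ x]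
    field_simp
  have hsum := hasSum_integral_of_summable_integral_norm
    (F := fun n x => (-1) ^ n * G n x) (μ := besselMeasure α)
    (fun n => ((integrable_pow_mul_gauss hα hs (2 * n)).const_mul (a n)).const_mul _) (by
      simp only [norm_mul, norm_pow, norm_neg, norm_one, one_pow, one_mul,
        Real.norm_of_nonneg (hG _ _), hGint]
      exact (Real.summable_pow_div_factorial _).mul_left _)
  simp only [integral_const_mul, hGint] at hsum
  simp only [hseries]
  rw [← hsum.tsum_eq, ← (hasSum_gauss s⁻¹ y).tsum_eq, ← tsum_mul_left]
  refine tsum_congr fun n => ?_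
  rw [neg_mul, neg_pow, mul_right_comm, ← div_eq_mul_inv]
  ring

theorem fourierBessel_gauss (y : ℝ) :
    fourierBessel α (fun x => (gauss s x : ℂ)) y =
      ((s ^ (-(α + 1)) * gauss s⁻¹ y : ℝ) : ℂ) := by
  rw [← integral_gauss_mul_besselj hα hs y, ← integral_complex_ofReal]
  simp only [fourierBessel, Complex.ofReal_mul]

end

/-! ### Uniqueness of moments and of Gaussian integrals -/

section Moments

variable {X : Type*} [TopologicalSpace X] [PolishSpace X] [MeasurableSpace X] [BorelSpace X]
  {φ : BoundedContinuousFunction X ℝ}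

theorem measure_ext_of_forall_integral_pow (hφ : Function.Injective φ) {P Q : Measure X}
    [IsFiniteMeasure P] [IsFiniteMeasure Q]
    (h : ∀ n : ℕ, ∫ x, φ x ^ n ∂P = ∫ x, φ x ^ n ∂Q) : P = Q := by
  let A : StarSubalgebra ℝ (BoundedContinuousFunction X ℝ) :=
    { (Polynomial.aeval φ).range with
      star_mem' := fun {a} ha => by rwa [show star a = a from BoundedContinuousFunction.ext
        fun _ => star_trivial _] }
  refine ext_of_forall_mem_subalgebra_integral_eq_of_polish (𝕜 := ℝ) (A := A) ?_ ?_
  · exact fun x y hxy => ⟨φ, ⟨BoundedContinuousFunction.toContinuousMapStarₐ ℝ φ,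
      ⟨φ, ⟨Polynomial.X, Polynomial.aeval_X φ⟩, rfl⟩, rfl⟩, hφ.ne hxy⟩
  · rintro _ ⟨p, rfl⟩
    change ∫ x, (Polynomial.aeval φ p) x ∂P = ∫ x, (Polynomial.aeval φ p) x ∂Q
    induction p using Polynomial.induction_on' with
    | add p q hp hq =>
      have hi (r : Polynomial ℝ) (R : Measure X) [IsFiniteMeasure R] :
          Integrable (fun x => (Polynomial.aeval φ r) x) R :=
        BoundedContinuousFunction.integrable _ _
      simp only [map_add, BoundedContinuousFunction.add_apply]
      rw [integral_add (hi p P) (hi q P), integral_add (hi p Q) (hi q Q), hp, hq]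
    | monomial n a =>
      have hval (x : X) : (Polynomial.aeval φ (Polynomial.monomial n a)) x = a * φ x ^ n := by
        simp [Polynomial.aeval_monomial]
      simp only [hval, integral_const_mul, h]

theorem ae_eq_zero_of_forall_integral_mul_pow_real (hφ : Function.Injective φ) {μ : Measure X}
    {q : X → ℝ} (hq : Integrable q μ) (h : ∀ n : ℕ, ∫ x, q x * φ x ^ n ∂μ = 0) : q =ᵐ[μ] 0 := by
  have hφn (n : ℕ) (x : X) : ‖(φ ^ n) x‖ ≤ ‖φ ^ n‖ := (φ ^ n).norm_coe_le_norm x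
  have hint {r : X → ℝ} (hr : Integrable r μ) (n : ℕ) :
      Integrable (fun x => max (r x) 0 * φ x ^ n) μ :=
    hr.pos_part.mul_bdd (φ ^ n).continuous.aestronglyMeasurable (.of_forall (hφn n))
  have hdens {r : X → ℝ} (hr : Integrable r μ) (n : ℕ) :
      ∫ x, φ x ^ n ∂(μ.withDensity fun x => ENNReal.ofReal (r x)) =
        ∫ x, max (r x) 0 * φ x ^ n ∂μ := by
    rw [integral_withDensity_eq_integral_toReal_smul₀ hr.aemeasurable.ennreal_ofReal (by simp)]
    simp only [ENNReal.toReal_ofReal', smul_eq_mul]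
  have := isFiniteMeasure_withDensity_ofReal hq.2
  have := isFiniteMeasure_withDensity_ofReal hq.neg.2
  have heq : (μ.withDensity fun x => ENNReal.ofReal (q x)) =
      μ.withDensity fun x => ENNReal.ofReal ((-q) x) := by
    refine measure_ext_of_forall_integral_pow hφ fun n => ?_
    rw [hdens hq, hdens hq.neg, ← sub_eq_zero, ← integral_sub (hint hq n) (hint hq.neg n)]
    simp only [Pi.neg_apply, ← sub_mul, max_zero_sub_eq_self, h]
  rw [withDensity_eq_iff hq.aemeasurable.ennreal_ofReal hq.neg.aemeasurable.ennreal_ofReal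
    (by simpa [← ofReal_norm] using hq.lintegral_lt_top.ne)] at heq
  filter_upwards [heq] with x hx
  have := congrArg ENNReal.toReal hx
  rw [ENNReal.toReal_ofReal', ENNReal.toReal_ofReal', Pi.neg_apply] at this
  simpa [this] using (max_zero_sub_eq_self (q x)).symm

theorem ae_eq_zero_of_forall_integral_mul_pow (hφ : Function.Injective φ) {μ : Measure X}
    {q : X → ℂ} (hq : Integrable q μ) (h : ∀ n : ℕ, ∫ x, q x * (φ x : ℂ) ^ n ∂μ = 0) :
    q =ᵐ[μ] 0 := by
  have hint (n : ℕ) : Integrable (fun x => q x * (φ x : ℂ) ^ n) μ := by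
    refine hq.mul_bdd (c := ‖φ ^ n‖) (by fun_prop) (.of_forall fun x => ?_)
    simpa using (φ ^ n).norm_coe_le_norm x
  have hre := ae_eq_zero_of_forall_integral_mul_pow_real hφ hq.re fun n => by
    have := integral_re (hint n)
    rw [h n] at this
    simpa [← Complex.ofReal_pow] using this
  have him := ae_eq_zero_of_forall_integral_mul_pow_real hφ hq.im fun n => by
    have := integral_im (hint n)
    rw [h n] at this
    simpa [← Complex.ofReal_pow] using this
  filter_upwards [hre, him] with x h1 h2
  exact Complex.ext h1 h2

end Moments

theorem gauss_natCast (n : ℕ) (x : ℝ) : gauss n x = gauss 1 x ^ n := by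
  rw [gauss, gauss, ← Real.exp_nat_mul]
  ring_nf

theorem gauss_injOn : Set.InjOn (gauss 1) (Set.Ioi 0) := by
  intro x hx y hy h
  rw [gauss, gauss, Real.exp_eq_exp] at h
  have hsq : x ^ 2 = y ^ 2 := mul_left_cancel₀ (by simp [Real.pi_ne_zero]) h
  exact (sq_eq_sq₀ (le_of_lt hx) (le_of_lt hy)).1 hsq

theorem gauss_le_one {s : ℝ} (hs : 0 ≤ s) (x : ℝ) : gauss s x ≤ 1 :=
  Real.exp_le_one_iff.2 (by rw [neg_mul, neg_nonpos]; positivity)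

theorem ae_eq_zero_of_forall_integral_mul_gauss {α : ℝ} {h : ℝ → ℂ}
    (hi : Integrable (fun x => h x * (gauss 1 x : ℂ)) (besselMeasure α))
    (h0 : ∀ s : ℝ, 0 < s → ∫ x, h x * (gauss s x : ℂ) ∂(besselMeasure α) = 0) :
    h =ᵐ[besselMeasure α] 0 := by
  have hIoi : (besselMeasure α).restrict (Set.Ioi 0) = besselMeasure α :=
    Measure.restrict_eq_self_of_ae_mem (ae_besselMeasure_pos α)
  have : PolishSpace (Set.Ioi (0 : ℝ)) := isOpen_Ioi.polishSpace
  let φ : BoundedContinuousFunction (Set.Ioi (0 : ℝ)) ℝ :=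
    .ofNormedAddCommGroup (fun x => gauss 1 x) ((continuous_gauss 1).comp continuous_subtype_val)
      1 fun x => by simpa [abs_of_pos (gauss_pos _ _)] using gauss_le_one zero_le_one x
  have hφ : Function.Injective φ := fun x y hxy => Subtype.ext (gauss_injOn x.2 y.2 hxy)
  have hmap : ((besselMeasure α).comap ((↑) : Set.Ioi (0 : ℝ) → ℝ)).map (↑) = besselMeasure α := by
    rw [map_comap_subtype_coe measurableSet_Ioi, hIoi]
  have hzero := ae_eq_zero_of_forall_integral_mul_pow hφ
    (μ := (besselMeasure α).comap ((↑) : Set.Ioi (0 : ℝ) → ℝ))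
    (q := fun x => h x * (gauss 1 x : ℂ))
    ((MeasurableEmbedding.subtype_coe measurableSet_Ioi).integrable_map_iff.1
      (by rwa [hmap])) fun n => by
    rw [← h0 (1 + n) (by positivity), ← hIoi, ← integral_subtype_comap measurableSet_Ioi, hIoi]
    refine integral_congr_ae (.of_forall fun x => ?_)
    simp only [mul_assoc, ← gauss_mul_gauss 1, gauss_natCast, Complex.ofReal_mul,
      Complex.ofReal_pow]
    rfl
  rw [← hmap]
  refine (MeasurableEmbedding.subtype_coe measurableSet_Ioi).ae_map_iff.2 ?_
  filter_upwards [hzero] with x hx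
  exact (mul_eq_zero.1 hx).resolve_right (Complex.ofReal_ne_zero.2 (gauss_pos 1 x).ne')

/-! ### The Fourier–Bessel transform on `L²_α` -/

section GramMatrix

variable {𝕜 ι E G : Type*} [RCLike 𝕜] [NormedAddCommGroup E] [InnerProductSpace 𝕜 E]
  [NormedAddCommGroup G] [InnerProductSpace 𝕜 G] {a : ι → E} {b : ι → G}

theorem norm_linearCombination_eq_of_inner_eq
    (h : ∀ i j, inner 𝕜 (b i) (b j) = inner 𝕜 (a i) (a j)) (c : ι →₀ 𝕜) :
    ‖Finsupp.linearCombination 𝕜 b c‖ = ‖Finsupp.linearCombination 𝕜 a c‖ := by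
  have hinner : inner 𝕜 (Finsupp.linearCombination 𝕜 b c) (Finsupp.linearCombination 𝕜 b c) =
      inner 𝕜 (Finsupp.linearCombination 𝕜 a c) (Finsupp.linearCombination 𝕜 a c) := by
    simp only [Finsupp.linearCombination_apply, Finsupp.sum, sum_inner, inner_sum,
      inner_smul_left, inner_smul_right, h]
  rw [@norm_eq_sqrt_re_inner 𝕜, @norm_eq_sqrt_re_inner 𝕜, hinner]

theorem exists_linearIsometry_of_inner_eq [CompleteSpace G]
    (ha : Dense (Submodule.span 𝕜 (Set.range a) : Set E))
    (h : ∀ i j, inner 𝕜 (b i) (b j) = inner 𝕜 (a i) (a j)) :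
    ∃ F : E →ₗᵢ[𝕜] G, ∀ i, F (a i) = b i := by
  have hd : DenseRange (Finsupp.linearCombination 𝕜 a) := by
    rwa [DenseRange, ← LinearMap.coe_range, Finsupp.range_linearCombination]
  have hn := norm_linearCombination_eq_of_inner_eq h
  set e := Finsupp.linearCombination 𝕜 a
  set e' := Finsupp.linearCombination 𝕜 b
  have heq : ∀ c, e'.extendOfNorm e (e c) = e' c :=
    LinearMap.extendOfNorm_eq hd ⟨1, fun c => by rw [one_mul, hn]⟩
  refine ⟨⟨(e'.extendOfNorm e).toLinearMap, fun f => ?_⟩, fun i => ?_⟩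
  · refine hd.induction (P := fun f => ‖e'.extendOfNorm e f‖ = ‖f‖) ?_
      (isClosed_eq (by fun_prop) (by fun_prop)) f
    rintro _ ⟨c, rfl⟩
    rw [heq, hn]
  · simpa [e, e'] using heq (Finsupp.single i 1)

end GramMatrix

section Plancherel

variable {α : ℝ} (hα : -1 < α)

include hα in
theorem memLp_gauss {s : ℝ} (hs : 0 < s) :
    MemLp (fun x => (gauss s x : ℂ)) 2 (besselMeasure α) := by
  have hc : Continuous fun x => (gauss s x : ℂ) :=
    Complex.continuous_ofReal.comp (continuous_gauss s)
  rw [memLp_two_iff_integrable_sq_norm hc.aestronglyMeasurable]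
  simpa only [Complex.norm_real, Real.norm_eq_abs, sq_abs, sq, abs_mul_abs_self, gauss_mul_gauss]
    using integrable_gauss hα (add_pos hs hs)

/-- The Gaussians as elements of `L²_α`. -/
noncomputable def gaussLp (s : {s : ℝ // 0 < s}) : L2Bessel α := (memLp_gauss hα s.2).toLp _

theorem inner_gaussLp (s : {s : ℝ // 0 < s}) (f : L2Bessel α) :
    inner ℂ (gaussLp hα s) f = ∫ x, f x * (gauss s x : ℂ) ∂(besselMeasure α) := by
  rw [L2.inner_def]
  refine integral_congr_ae ?_
  filter_upwards [(memLp_gauss hα s.2).coeFn_toLp] with x hx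
  rw [gaussLp, hx, RCLike.inner_apply, Complex.conj_ofReal]

theorem inner_gaussLp_gaussLp (s t : {s : ℝ // 0 < s}) :
    inner ℂ (gaussLp hα s) (gaussLp hα t) =
      ((2 ^ α * Real.Gamma (α + 1) * ((s : ℝ) + t) ^ (-(α + 1)) : ℝ) : ℂ) := by
  rw [inner_gaussLp, ← integral_gauss hα (add_pos s.2 t.2), ← integral_complex_ofReal]
  refine integral_congr_ae ?_
  filter_upwards [(memLp_gauss hα t.2).coeFn_toLp] with x hx
  rw [gaussLp, hx, ← Complex.ofReal_mul, gauss_mul_gauss, add_comm (s : ℝ)]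

include hα in
theorem integrable_mul_gauss {s : ℝ} (hs : 0 < s) (f : L2Bessel α) :
    Integrable (fun x => f x * (gauss s x : ℂ)) (besselMeasure α) :=
  (Lp.memLp f).integrable_mul (memLp_gauss hα hs)

theorem dense_span_gaussLp :
    Dense (Submodule.span ℂ (Set.range (gaussLp hα)) : Set (L2Bessel α)) := by
  rw [Submodule.dense_iff_topologicalClosure_eq_top, Submodule.topologicalClosure_eq_top_iff,
    Submodule.eq_bot_iff]
  refine fun v hv => Lp.ext ((ae_eq_zero_of_forall_integral_mul_gauss
    (integrable_mul_gauss hα one_pos v) fun s hs => ?_).trans (Lp.coeFn_zero ..).symm)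
  rw [← inner_gaussLp hα ⟨s, hs⟩]
  exact (Submodule.mem_orthogonal _ v).1 hv _ (Submodule.subset_span ⟨_, rfl⟩)

/-- The Fourier–Bessel transforms of the Gaussians, as elements of `L²_α`; see
`fourierBessel_gauss`. -/
noncomputable def gaussLpTransform (s : {s : ℝ // 0 < s}) : L2Bessel α :=
  (((s : ℝ) ^ (-(α + 1)) : ℝ) : ℂ) • gaussLp hα ⟨(s : ℝ)⁻¹, inv_pos.2 s.2⟩

theorem inner_gaussLpTransform_gaussLpTransform (s t : {s : ℝ // 0 < s}) :
    inner ℂ (gaussLpTransform hα s) (gaussLpTransform hα t) =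
      inner ℂ (gaussLp hα s) (gaussLp hα t) := by
  have hs : (0 : ℝ) < s := s.2
  have ht : (0 : ℝ) < t := t.2
  rw [gaussLpTransform, gaussLpTransform, inner_smul_left, inner_smul_right,
    inner_gaussLp_gaussLp, inner_gaussLp_gaussLp, Complex.conj_ofReal, ← Complex.ofReal_mul,
    ← Complex.ofReal_mul, show (s : ℝ) + t = s * (t * ((s : ℝ)⁻¹ + (t : ℝ)⁻¹)) by field_simp; ring,
    Real.mul_rpow hs.le (by positivity), Real.mul_rpow ht.le (by positivity)]
  ring_nf

theorem inner_gaussLp_gaussLpTransform (s t : {s : ℝ // 0 < s}) :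
    inner ℂ (gaussLp hα s) (gaussLpTransform hα t) =
      inner ℂ (gaussLpTransform hα s) (gaussLp hα t) := by
  have hs : (0 : ℝ) < s := s.2
  have ht : (0 : ℝ) < t := t.2
  have hpow : (t : ℝ) ^ (-(α + 1)) * ((s : ℝ) + (t : ℝ)⁻¹) ^ (-(α + 1)) =
      (s : ℝ) ^ (-(α + 1)) * ((s : ℝ)⁻¹ + t) ^ (-(α + 1)) := by
    rw [← Real.mul_rpow ht.le (by positivity), ← Real.mul_rpow hs.le (by positivity)]
    field_simp
    ring_nf
  rw [gaussLpTransform, gaussLpTransform, inner_smul_left, inner_smul_right,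
    inner_gaussLp_gaussLp, inner_gaussLp_gaussLp, Complex.conj_ofReal, ← Complex.ofReal_mul,
    ← Complex.ofReal_mul]
  congr 1
  linear_combination (2 ^ α * Real.Gamma (α + 1)) * hpow

/-- The Fourier–Bessel transform on `L²_α`, as the isometry which maps each Gaussian to its
Fourier–Bessel transform. -/
noncomputable def fourierBesselL2 : L2Bessel α →ₗᵢ[ℂ] L2Bessel α :=
  (exists_linearIsometry_of_inner_eq (dense_span_gaussLp hα)
    (inner_gaussLpTransform_gaussLpTransform hα)).choose

theorem fourierBesselL2_gaussLp (s : {s : ℝ // 0 < s}) :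
    fourierBesselL2 hα (gaussLp hα s) = gaussLpTransform hα s :=
  (exists_linearIsometry_of_inner_eq (dense_span_gaussLp hα)
    (inner_gaussLpTransform_gaussLpTransform hα)).choose_spec s

theorem inner_gaussLp_fourierBesselL2 (t : {s : ℝ // 0 < s}) (f : L2Bessel α) :
    inner ℂ (gaussLp hα t) (fourierBesselL2 hα f) = inner ℂ (gaussLpTransform hα t) f := by
  have heq : innerSL ℂ (gaussLp hα t) ∘L (fourierBesselL2 hα).toContinuousLinearMap =
      innerSL ℂ (gaussLpTransform hα t) := by
    refine ContinuousLinearMap.ext_on (dense_span_gaussLp hα) ?_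
    rintro _ ⟨s, rfl⟩
    simp [fourierBesselL2_gaussLp, inner_gaussLp_gaussLpTransform]
  exact DFunLike.congr_fun heq f

end Plancherel

theorem neg_one_lt_of_neg_half_le {α : ℝ} (hα : -1 / 2 ≤ α) : -1 < α := by linarith

theorem fourierBessel_mul_gauss (α t : ℝ) (f : ℝ → ℂ) (y : ℝ) :
    fourierBessel α f y * (gauss t y : ℂ) =
      ∫ x, f x * (gauss t y : ℂ) * (besselj α (2 * Real.pi * x * y) : ℂ) ∂(besselMeasure α) := by
  rw [fourierBessel, ← integral_mul_const]
  simp only [mul_right_comm]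

section Integral

variable {α γ : ℝ} (hα : -1 / 2 ≤ α) (hγ₀ : 0 ≤ γ) (hγ : γ ≤ α + 1 / 2) {f : ℝ → ℂ}
  (hf : Integrable (fun x => ((x ^ (-γ) : ℝ) : ℂ) * f x) (besselMeasure α)) {t : ℝ} (ht : 0 < t)
include hα hγ₀ hγ hf ht

theorem integrable_fourierBessel_kernel :
    Integrable (fun p : ℝ × ℝ =>
      f p.1 * (gauss t p.2 : ℂ) * (besselj α (2 * Real.pi * p.1 * p.2) : ℂ))
      ((besselMeasure α).prod (besselMeasure α)) := by
  obtain ⟨C, -, hC⟩ := exists_abs_besselj_le_mul_rpow_neg hα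
  have hj : Continuous fun p : ℝ × ℝ => besselj α (2 * Real.pi * p.1 * p.2) :=
    (continuous_besselj (by linarith)).comp (by fun_prop)
  have hprod := hf.mul_prod (integrable_rpow_mul_gauss (α := α) (r := -γ) ht (by linarith)).ofReal
  have hpos : ∀ᵐ p ∂(besselMeasure α).prod (besselMeasure α), 0 < p.1 ∧ 0 < p.2 :=
    (Measure.quasiMeasurePreserving_fst.ae (ae_besselMeasure_pos α)).and
      (Measure.quasiMeasurePreserving_snd.ae (ae_besselMeasure_pos α))
  refine (hprod.mul_bdd (g := fun p =>
    (((p.1 * p.2) ^ γ * besselj α (2 * Real.pi * p.1 * p.2) : ℝ) : ℂ))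
    (c := C * (2 * Real.pi) ^ (-γ)) ?_ ?_).congr ?_
  · exact (Complex.measurable_ofReal.comp (((measurable_fst.mul measurable_snd).pow_const γ).mul
      hj.measurable)).aestronglyMeasurable
  · filter_upwards [hpos] with p ⟨hx, hy⟩
    rw [Complex.norm_real, norm_mul, Real.norm_of_nonneg (by positivity), Real.norm_eq_abs]
    refine (mul_le_mul_of_nonneg_left (hC _ (by positivity) γ hγ₀ hγ) (by positivity)).trans_eq ?_
    rw [mul_assoc _ p.1, Real.mul_rpow (x := 2 * Real.pi) (by positivity) (by positivity),
      Real.rpow_neg (mul_pos hx hy).le]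
    field_simp
  · filter_upwards [hpos] with p ⟨hx, hy⟩
    have hxy : p.1 ^ (-γ) * p.2 ^ (-γ) * (p.1 * p.2) ^ γ = 1 := by
      rw [← Real.mul_rpow hx.le hy.le, ← Real.rpow_add (mul_pos hx hy), neg_add_cancel,
        Real.rpow_zero]
    have hxy' := congrArg Complex.ofReal hxy
    push_cast at hxy' ⊢
    linear_combination (f p.1 * (gauss t p.2 : ℂ) * (besselj α (2 * Real.pi * p.1 * p.2) : ℂ)) *
      hxy'

theorem integrable_fourierBessel_mul_gauss :
    Integrable (fun y => fourierBessel α f y * (gauss t y : ℂ)) (besselMeasure α) := by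
  simp only [fourierBessel_mul_gauss]
  exact (integrable_fourierBessel_kernel hα hγ₀ hγ hf ht).integral_prod_right

theorem integral_fourierBessel_mul_gauss :
    ∫ y, fourierBessel α f y * (gauss t y : ℂ) ∂(besselMeasure α) =
      ((t ^ (-(α + 1)) : ℝ) : ℂ) * ∫ x, f x * (gauss t⁻¹ x : ℂ) ∂(besselMeasure α) := by
  have hinner (x : ℝ) : ∫ y, f x * (gauss t y : ℂ) * (besselj α (2 * Real.pi * x * y) : ℂ)
      ∂(besselMeasure α) = ((t ^ (-(α + 1)) : ℝ) : ℂ) * (f x * (gauss t⁻¹ x : ℂ)) := by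
    have h := fourierBessel_gauss (neg_one_lt_of_neg_half_le hα) ht x
    simp only [fourierBessel, mul_right_comm (2 * Real.pi) _ x] at h
    simp only [mul_assoc (f x)]
    rw [integral_const_mul, h]
    push_cast
    ring
  simp only [fourierBessel_mul_gauss]
  rw [← integral_integral_swap (integrable_fourierBessel_kernel hα hγ₀ hγ hf ht),
    ← integral_const_mul]
  simp only [hinner]

end Integral

theorem fourierBesselL2_ae_eq_fourierBessel {α γ : ℝ} (hα : -1 / 2 ≤ α) (hγ₀ : 0 ≤ γ)
    (hγ : γ ≤ α + 1 / 2) (f : L2Bessel α)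
    (hf : Integrable (fun x => ((x ^ (-γ) : ℝ) : ℂ) * f x) (besselMeasure α)) :
    fourierBesselL2 (neg_one_lt_of_neg_half_le hα) f =ᵐ[besselMeasure α] fourierBessel α f := by
  have hα' := neg_one_lt_of_neg_half_le hα
  have hi {t : ℝ} (ht : 0 < t) := integrable_mul_gauss hα' ht (fourierBesselL2 hα' f)
  have hi' {t : ℝ} (ht : 0 < t) := integrable_fourierBessel_mul_gauss hα hγ₀ hγ hf ht
  rw [← sub_ae_eq_zero]
  refine ae_eq_zero_of_forall_integral_mul_gauss ?_ fun t ht => ?_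
  · simp only [Pi.sub_apply, sub_mul]
    exact (hi one_pos).sub (hi' one_pos)
  · simp only [Pi.sub_apply, sub_mul]
    rw [integral_sub (hi ht) (hi' ht), integral_fourierBessel_mul_gauss hα hγ₀ hγ hf ht,
      ← inner_gaussLp hα' ⟨t, ht⟩, inner_gaussLp_fourierBesselL2, gaussLpTransform, inner_smul_left,
      Complex.conj_ofReal, inner_gaussLp, sub_self]

theorem isFourierBesselL2_fourierBesselL2 {α : ℝ} (hα : -1 / 2 ≤ α) :
    IsFourierBesselL2 α (fourierBesselL2 (neg_one_lt_of_neg_half_le hα)) := fun f hf =>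
  fourierBesselL2_ae_eq_fourierBessel (γ := 0) hα le_rfl (by linarith) f (by simpa using hf)

/-! ### Compact operators and annihilating pairs in Hilbert spaces -/

theorem exists_subseq_tendsto_inner {𝕜 E : Type*} [RCLike 𝕜] [NormedAddCommGroup E]
    [InnerProductSpace 𝕜 E] [CompleteSpace E] [TopologicalSpace.SeparableSpace E]
    {u : ℕ → E} {M : ℝ} (hu : ∀ n, ‖u n‖ ≤ M) :
    ∃ f : E, ‖f‖ ≤ M ∧ ∃ φ : ℕ → ℕ, StrictMono φ ∧
      ∀ k : E, Tendsto (fun n => inner 𝕜 k (u (φ n))) atTop (𝓝 (inner 𝕜 k f)) := by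
  obtain ⟨a, ha, φ, hφ, hlim⟩ := WeakDual.isSeqCompact_closedBall 𝕜 E 0 M
    (x := fun n => StrongDual.toWeakDual (innerSL 𝕜 (u n))) (fun n => by simpa using hu n)
  refine ⟨(InnerProductSpace.toDual 𝕜 E).symm (WeakDual.toStrongDual a), by simpa using ha, φ, hφ,
    fun k => ?_⟩
  have heval : Tendsto (fun n => inner 𝕜 (u (φ n)) k) atTop (𝓝 (a k)) :=
    ((WeakDual.eval_continuous k).tendsto a).comp hlim
  have hconj := (RCLike.continuous_conj.tendsto (a k)).comp heval
  simp only [Function.comp_def, inner_conj_symm] at hconj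
  rwa [← inner_conj_symm, InnerProductSpace.toDual_symm_apply]

theorem tendsto_Lp_of_dominated {X E : Type*} [MeasurableSpace X] {μ : Measure X}
    [NormedAddCommGroup E] {p : ENNReal} [hp : Fact (1 ≤ p)] (hp' : p ≠ ⊤)
    {u : ℕ → Lp E p μ} {f : Lp E p μ} {G : X → ℝ} (hG : MemLp G p μ)
    (hbound : ∀ n, ∀ᵐ x ∂μ, ‖u n x‖ ≤ G x)
    (hlim : ∀ᵐ x ∂μ, Tendsto (fun n => u n x) atTop (𝓝 (f x))) :
    Tendsto u atTop (𝓝 f) := by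
  have hle : ∀ n (s : Set X), eLpNorm (s.indicator (u n)) p μ ≤ eLpNorm (s.indicator G) p μ := by
    intro n s
    refine eLpNorm_mono_ae_real ?_
    filter_upwards [hbound n] with x hx
    by_cases hs : x ∈ s <;> simp [hs, hx]
  rw [Lp.tendsto_Lp_iff_tendsto_eLpNorm']
  refine tendsto_Lp_of_tendsto_ae hp.out hp' (fun n => Lp.aestronglyMeasurable _) (Lp.memLp f)
    (fun ε hε => ?_) (fun ε hε => ?_) hlim
  · obtain ⟨δ, hδ, h⟩ := unifIntegrable_const (ι := Unit) hp.out hp' hG hε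
    exact ⟨δ, hδ, fun n s hs hμs => (hle n s).trans (h () s hs hμs)⟩
  · obtain ⟨s, hμs, h⟩ := unifTight_const (ι := Unit) hp' hG hε
    exact ⟨s, hμs, fun n => (hle n sᶜ).trans (h ())⟩

theorem isCompactOperator_of_ae_eq_inner {𝕜 E X : Type*} [RCLike 𝕜] [NormedAddCommGroup E]
    [InnerProductSpace 𝕜 E] [CompleteSpace E] [TopologicalSpace.SeparableSpace E]
    [MeasurableSpace X] {μ : Measure X} {p : ENNReal} [Fact (1 ≤ p)] (hp : p ≠ ⊤)
    {K : E →L[𝕜] Lp 𝕜 p μ} {k : X → E} {G : X → ℝ} (hG : MemLp G p μ)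
    (hk : ∀ᵐ x ∂μ, ‖k x‖ ≤ G x) (hK : ∀ f, K f =ᵐ[μ] fun x => inner 𝕜 (k x) f) :
    IsCompactOperator K := by
  refine (isCompactOperator_iff_image_closedBall_subset_compact (K : E →ₗ[𝕜] Lp 𝕜 p μ) one_pos).2
    ⟨_, IsSeqCompact.isCompact fun v hv => ?_, subset_rfl⟩
  choose u hu huv using hv
  have hu1 : ∀ n, ‖u n‖ ≤ 1 := fun n => by simpa using hu n
  obtain ⟨f, hf1, φ, hφ, hweak⟩ := exists_subseq_tendsto_inner (𝕜 := 𝕜) hu1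
  refine ⟨K f, ⟨f, by simpa using hf1, rfl⟩, φ, hφ, ?_⟩
  rw [show v = fun n => K (u n) from funext fun n => (huv n).symm]
  refine tendsto_Lp_of_dominated hp hG (fun n => ?_) ?_
  · filter_upwards [hK (u (φ n)), hk] with x hKx hkx
    calc ‖K (u (φ n)) x‖ ≤ ‖k x‖ * ‖u (φ n)‖ := hKx ▸ norm_inner_le_norm _ _
      _ ≤ ‖k x‖ * 1 := by gcongr; exact hu1 _
      _ ≤ G x := by rwa [mul_one]
  · filter_upwards [hK f, ae_all_iff.2 fun n => hK (u (φ n))] with x hfx hux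
    simpa only [Function.comp_apply, hfx, hux] using hweak (k x)

theorem finiteDimensional_eigenspace_of_isCompactOperator {𝕜 E : Type*} [RCLike 𝕜]
    [NormedAddCommGroup E] [NormedSpace 𝕜 E] {A : E →L[𝕜] E} (hA : IsCompactOperator A) {μ : 𝕜}
    (hμ : μ ≠ 0) : FiniteDimensional 𝕜 (Module.End.eigenspace (A : E →ₗ[𝕜] E) μ) := by
  set W := Module.End.eigenspace (A : E →ₗ[𝕜] E) μ
  have hW : ∀ f ∈ W, A f = μ • f := fun f hf => Module.End.mem_eigenspace_iff.1 hf
  have hclosed : IsClosed (W : Set E) := by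
    convert (A - μ • (1 : E →L[𝕜] E)).isClosed_ker using 2
    ext f
    simp [W, sub_eq_zero]
  have hmaps : ∀ f ∈ W, A f ∈ W := fun f hf => hW f hf ▸ W.smul_mem μ hf
  have hrestrict : IsCompactOperator ((A : E →ₗ[𝕜] E).restrict hmaps) := hA.restrict hmaps hclosed
  refine FiniteDimensional.of_isCompactOperator_id (𝕜 := 𝕜) ?_
  have hid : (id : W → W) = μ⁻¹ • (A : E →ₗ[𝕜] E).restrict hmaps := by
    funext f
    exact Subtype.ext (by simp [hW f f.2, smul_smul, hμ])
  exact hid ▸ hrestrict.smul μ⁻¹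

section AnnihilatingPair

open scoped InnerProduct

variable {𝕜 H H' : Type*} [RCLike 𝕜] [NormedAddCommGroup H] [InnerProductSpace 𝕜 H]
  [NormedAddCommGroup H'] [InnerProductSpace 𝕜 H']
  {F : H →ₗᵢ[𝕜] H'} {U : Submodule 𝕜 H} {V : Submodule 𝕜 H'} [U.HasOrthogonalProjection]
  [V.HasOrthogonalProjection]

variable (F U V) in
/-- The operator `P_V F P_U` that localizes an isometry `F` to the subspaces `U` and `V`. -/
noncomputable def localization : H →L[𝕜] H' :=
  V.starProjection ∘L F.toContinuousLinearMap ∘L U.starProjection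

theorem localization_apply (f : H) :
    localization F U V f = V.starProjection (F (U.starProjection f)) := rfl

theorem localization_apply_eq {f : H} (hf : f ∈ U) (hFf : F f ∈ V) :
    localization F U V f = F f := by
  rw [localization_apply, Submodule.starProjection_eq_self_iff.2 hf,
    Submodule.starProjection_eq_self_iff.2 hFf]

theorem mem_of_norm_le_norm_localization {f : H} (h : ‖f‖ ≤ ‖localization F U V f‖) :
    f ∈ U ∧ F f ∈ V := by
  have hV := V.norm_starProjection_apply_le (F (U.starProjection f))
  have hU := U.norm_starProjection_apply_le f
  rw [F.norm_map] at hV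
  rw [localization_apply] at h
  have hfU : f ∈ U := (U.mem_iff_norm_starProjection f).2 (hU.antisymm (h.trans hV))
  rw [Submodule.starProjection_eq_self_iff.2 hfU] at h
  exact ⟨hfU, (V.mem_iff_norm_starProjection (F f)).2
    ((V.norm_starProjection_apply_le _).antisymm (by rwa [F.norm_map]))⟩

theorem norm_localization_sub_le (f : H) :
    ‖localization F U V f - F f‖ ≤ ‖f - U.starProjection f‖ + ‖F f - V.starProjection (F f)‖ := by
  have hsplit : localization F U V f - F f =
      -V.starProjection (F (f - U.starProjection f)) - (F f - V.starProjection (F f)) := by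
    rw [localization_apply, map_sub, map_sub]
    abel
  calc ‖localization F U V f - F f‖
      ≤ ‖V.starProjection (F (f - U.starProjection f))‖ + ‖F f - V.starProjection (F f)‖ := by
        rw [hsplit, ← norm_neg (V.starProjection _)]
        exact norm_sub_le _ _
    _ ≤ _ := by
        gcongr
        exact (V.norm_starProjection_apply_le _).trans_eq (F.norm_map _)

variable [CompleteSpace H] [CompleteSpace H']

theorem adjoint_apply_self (f : H) : (F.toContinuousLinearMap†) (F f) = f :=
  ext_inner_right 𝕜 fun g => by
    rw [ContinuousLinearMap.adjoint_inner_left]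
    exact F.inner_map_map f g

theorem norm_adjoint_apply_le (g : H') : ‖(F.toContinuousLinearMap†) g‖ ≤ ‖g‖ :=
  ((F.toContinuousLinearMap†).le_of_opNorm_le
    ((ContinuousLinearMap.adjoint.norm_map _).trans_le F.norm_toContinuousLinearMap_le) g).trans_eq
    (one_mul _)

theorem adjoint_localization_eq_self_iff {f : H} :
    (F.toContinuousLinearMap†) (localization F U V f) = f ↔ f ∈ U ∧ F f ∈ V := by
  refine ⟨fun h => mem_of_norm_le_norm_localization ?_, fun ⟨hf, hFf⟩ => ?_⟩
  · conv_lhs => rw [← h]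
    exact norm_adjoint_apply_le _
  · rw [localization_apply_eq hf hFf, adjoint_apply_self]

theorem eigenspace_adjoint_comp_localization :
    Module.End.eigenspace
      ((F.toContinuousLinearMap† ∘L localization F U V : H →L[𝕜] H) : H →ₗ[𝕜] H) 1 =
      U ⊓ V.comap F.toLinearMap := by
  ext f
  simp only [Module.End.mem_eigenspace_iff, one_smul, ContinuousLinearMap.coe_coe,
    ContinuousLinearMap.comp_apply, adjoint_localization_eq_self_iff]
  rfl

theorem finiteDimensional_inf_comap_of_isCompactOperator_localization
    (hK : IsCompactOperator (localization F U V)) :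
    FiniteDimensional 𝕜 ↥(U ⊓ V.comap F.toLinearMap) := by
  rw [← eigenspace_adjoint_comp_localization]
  exact finiteDimensional_eigenspace_of_isCompactOperator
    (hK.clm_comp (F.toContinuousLinearMap†)) one_ne_zero

theorem exists_norm_le_mul_of_isCompactOperator_localization
    (hK : IsCompactOperator (localization F U V)) (h : U ⊓ V.comap F.toLinearMap = ⊥) :
    ∃ C : ℝ, 0 ≤ C ∧ ∀ f : H, ‖f‖ ≤
      C * (‖f - U.starProjection f‖ + ‖F f - V.starProjection (F f)‖) := by
  set A : H →L[𝕜] H := F.toContinuousLinearMap† ∘L localization F U V with hA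
  have hne : ¬ Module.End.HasEigenvalue (A : Module.End 𝕜 H) 1 := by
    rw [Module.End.hasEigenvalue_iff, not_not]
    exact eigenspace_adjoint_comp_localization.trans h
  obtain ⟨C, hC⟩ := IsCompactOperator.antilipschitz_of_not_hasEigenvalue
    (hK.clm_comp (F.toContinuousLinearMap†)) one_ne_zero hne
  refine ⟨C, C.coe_nonneg, fun f => ?_⟩
  calc ‖f‖ ≤ C * ‖A f - f‖ := by simpa using hC.le_mul_norm (map_zero _) f
    _ = C * ‖(F.toContinuousLinearMap†) (localization F U V f - F f)‖ := by
      rw [map_sub, adjoint_apply_self, hA, ContinuousLinearMap.comp_apply]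
    _ ≤ _ := by
      gcongr
      exact (norm_adjoint_apply_le _).trans (norm_localization_sub_le f)

end AnnihilatingPair

/-! ### Functions that vanish outside a set -/

section VanishOutside

variable {𝕜 X : Type*} [RCLike 𝕜] [MeasurableSpace X] {μ : Measure X} {A B : Set X}

variable (𝕜 μ A) in
/-- The closed subspace of `L²(μ)` that consists of the functions vanishing almost everywhere
outside the (measurable) set `A`, as the kernel of the restriction to `Aᶜ`. -/
noncomputable def vanishOutside : Submodule 𝕜 (Lp 𝕜 2 μ) :=
  (LpToLpRestrictCLM X 𝕜 𝕜 μ 2 Aᶜ).ker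

theorem mem_vanishOutside (hA : MeasurableSet A) {f : Lp 𝕜 2 μ} :
    f ∈ vanishOutside 𝕜 μ A ↔ ∀ᵐ x ∂μ, x ∉ A → f x = 0 := by
  have hae : LpToLpRestrictCLM X 𝕜 𝕜 μ 2 Aᶜ f = 0 ↔ f =ᵐ[μ.restrict Aᶜ] 0 := by
    rw [Lp.eq_zero_iff_ae_eq_zero]
    exact ⟨fun h => (LpToLpRestrictCLM_coeFn 𝕜 Aᶜ f).symm.trans h,
      fun h => (LpToLpRestrictCLM_coeFn 𝕜 Aᶜ f).trans h⟩
  exact hae.trans (ae_restrict_iff' hA.compl)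

theorem vanishOutside_mono (hA : MeasurableSet A) (hB : MeasurableSet B) (h : A ⊆ B) :
    vanishOutside 𝕜 μ A ≤ vanishOutside 𝕜 μ B := fun f hf => by
  rw [mem_vanishOutside hB]
  filter_upwards [(mem_vanishOutside hA).1 hf] with x hx hxB
  exact hx fun hxA => hxB (h hxA)

instance : CompleteSpace (vanishOutside 𝕜 μ A) :=
  (LpToLpRestrictCLM X 𝕜 𝕜 μ 2 Aᶜ).completeSpace_ker

theorem starProjection_vanishOutside_ae_eq (hA : MeasurableSet A) (f : Lp 𝕜 2 μ) :
    (vanishOutside 𝕜 μ A).starProjection f =ᵐ[μ] A.indicator f := by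
  have hmem : MemLp (A.indicator f) 2 μ := (Lp.memLp f).indicator hA
  suffices (vanishOutside 𝕜 μ A).starProjection f = hmem.toLp _ from
    this ▸ hmem.coeFn_toLp
  refine Submodule.eq_starProjection_of_mem_of_inner_eq_zero ?_ fun g hg => ?_
  · rw [mem_vanishOutside hA]
    filter_upwards [hmem.coeFn_toLp] with x hx hxA
    rw [hx, Set.indicator_of_notMem hxA]
  · rw [L2.inner_def]
    refine integral_eq_zero_of_ae ?_
    filter_upwards [(mem_vanishOutside hA).1 hg, hmem.coeFn_toLp, Lp.coeFn_sub f (hmem.toLp _)]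
      with x hgx hx hsub
    by_cases hxA : x ∈ A
    · have hzero : (f - hmem.toLp _) x = 0 := by
        rw [hsub, Pi.sub_apply, hx, Set.indicator_of_mem hxA, sub_self]
      simp only [hzero, inner_zero_left, Pi.zero_apply]
    · simp [hgx hxA]

theorem norm_sub_starProjection_vanishOutside (hA : MeasurableSet A) (f : Lp 𝕜 2 μ) :
    ‖f - (vanishOutside 𝕜 μ A).starProjection f‖ =
      (eLpNorm f 2 (μ.restrict Aᶜ)).toReal := by
  rw [Lp.norm_def, ← eLpNorm_indicator_eq_eLpNorm_restrict hA.compl, Set.indicator_compl]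
  refine congrArg ENNReal.toReal (eLpNorm_congr_ae ?_)
  exact (Lp.coeFn_sub _ _).trans
    ((EventuallyEq.refl _ _).sub (starProjection_vanishOutside_ae_eq hA f))

theorem isCompactOperator_localization_vanishOutside {E : Type*} [NormedAddCommGroup E]
    [InnerProductSpace 𝕜 E] [CompleteSpace E] [TopologicalSpace.SeparableSpace E]
    {F : E →ₗᵢ[𝕜] Lp 𝕜 2 μ} {U : Submodule 𝕜 E} [U.HasOrthogonalProjection]
    (hB : MeasurableSet B) {k : X → E} {G : X → ℝ} (hG : MemLp (B.indicator G) 2 μ)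
    (hk : ∀ᵐ x ∂μ, ‖k x‖ ≤ G x) (hF : ∀ f ∈ U, F f =ᵐ[μ] fun x => inner 𝕜 (k x) f) :
    IsCompactOperator (localization F U (vanishOutside 𝕜 μ B)) := by
  refine isCompactOperator_of_ae_eq_inner (k := B.indicator fun x => U.starProjection (k x))
    (by simp) hG ?_ fun f => ?_
  · filter_upwards [hk] with x hx
    by_cases hxB : x ∈ B
    · simpa [hxB] using (U.norm_starProjection_apply_le _).trans hx
    · simp [hxB]
  · filter_upwards [starProjection_vanishOutside_ae_eq hB (F (U.starProjection f)),
      hF _ (U.starProjection_apply_mem f)] with x hx hFx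
    rw [localization_apply, hx]
    by_cases hxB : x ∈ B
    · rw [Set.indicator_of_mem hxB, Set.indicator_of_mem hxB, hFx,
        U.inner_starProjection_left_eq_right]
    · simp [hxB]

end VanishOutside

/-! ### Compactness of the localized transform -/

section Compactness

variable {α : ℝ} {S T : Set ℝ}

theorem memLp_indicator_rpow (α : ℝ) (hS : MeasurableSet S) (hSf : volume S < ⊤) :
    MemLp (S.indicator fun x => x ^ (-(α + 1 / 2))) 2 (besselMeasure α) := by
  have hmeas : Measurable (S.indicator fun x : ℝ => x ^ (-(α + 1 / 2))) :=
    Measurable.indicator (by fun_prop) hS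
  rw [memLp_two_iff_integrable_sq_norm hmeas.aestronglyMeasurable, integrable_besselMeasure_iff]
  have hconst : Integrable (S.indicator fun _ : ℝ => (2 * Real.pi) ^ (α + 1)) volume :=
    (integrable_indicator_iff hS).2 (integrableOn_const hSf.ne)
  refine hconst.integrableOn.congr_fun (fun x (hx : 0 < x) => ?_) measurableSet_Ioi
  by_cases hxS : x ∈ S
  · have hpow : x ^ (2 * α + 1) * (x ^ (-(α + 1 / 2))) ^ 2 = 1 := by
      rw [← Real.rpow_mul_natCast hx.le, ← Real.rpow_add hx, ← Real.rpow_zero x]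
      congr 1
      push_cast
      ring
    simp only [Set.indicator_of_mem hxS, Real.norm_eq_abs, sq_abs, smul_eq_mul, besselWeight]
    rw [mul_assoc, hpow, mul_one]
  · simp [hxS]

theorem integrable_rpow_mul_of_mem_vanishOutside (hS : MeasurableSet S) (hSf : volume S < ⊤)
    {f : L2Bessel α} (hf : f ∈ vanishOutside ℂ (besselMeasure α) S) :
    Integrable (fun x => ((x ^ (-(α + 1 / 2)) : ℝ) : ℂ) * f x) (besselMeasure α) := by
  refine ((memLp_indicator_rpow α hS hSf).ofReal (K := ℂ)).integrable_mul (Lp.memLp f)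
    |>.congr ?_
  filter_upwards [(mem_vanishOutside hS).1 hf] with x hx
  by_cases hxS : x ∈ S
  · simp [hxS]
  · simp [hxS, hx hxS]

theorem fourierBesselL2_ae_eq_of_mem_vanishOutside (hα : -1 / 2 ≤ α) (hS : MeasurableSet S)
    (hSf : volume S < ⊤) {f : L2Bessel α} (hf : f ∈ vanishOutside ℂ (besselMeasure α) S) :
    fourierBesselL2 (neg_one_lt_of_neg_half_le hα) f =ᵐ[besselMeasure α] fourierBessel α f :=
  fourierBesselL2_ae_eq_fourierBessel hα (by linarith) le_rfl f
    (integrable_rpow_mul_of_mem_vanishOutside hS hSf hf)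

theorem exists_abs_besselj_mul_le (hα : -1 / 2 ≤ α) : ∃ C : ℝ, ∀ x y, 0 < x → 0 < y →
    |besselj α (2 * Real.pi * x * y)| ≤ C * y ^ (-(α + 1 / 2)) * x ^ (-(α + 1 / 2)) := by
  obtain ⟨C, -, hC⟩ := exists_abs_besselj_le_mul_rpow_neg hα
  refine ⟨C * (2 * Real.pi) ^ (-(α + 1 / 2)), fun x y hx hy => ?_⟩
  have hle := hC (2 * Real.pi * x * y) (by positivity) (α + 1 / 2) (by linarith) le_rfl
  rw [Real.mul_rpow (by positivity) hy.le, Real.mul_rpow (by positivity) hx.le] at hle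
  linarith

theorem exists_fourierBessel_eq_inner (hα : -1 / 2 ≤ α) (hS : MeasurableSet S)
    (hSf : volume S < ⊤) :
    ∃ B : ℝ, ∀ y, 0 < y → ∃ k : L2Bessel α, ‖k‖ ≤ B * y ^ (-(α + 1 / 2)) ∧
      ∀ f ∈ vanishOutside ℂ (besselMeasure α) S, fourierBessel α f y = inner ℂ k f := by
  obtain ⟨C, hC⟩ := exists_abs_besselj_mul_le hα
  have hρ := memLp_indicator_rpow α hS hSf
  refine ⟨C * ‖hρ.toLp _‖, fun y hy => ?_⟩
  set κ : ℝ → ℂ := S.indicator fun x => (besselj α (2 * Real.pi * x * y) : ℂ)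
  have hj : Continuous fun x => besselj α (2 * Real.pi * x * y) :=
    (continuous_besselj (neg_one_lt_of_neg_half_le hα)).comp (by fun_prop)
  have hκ : ∀ᵐ x ∂(besselMeasure α), ‖κ x‖ ≤
      C * y ^ (-(α + 1 / 2)) * ‖S.indicator (fun x => x ^ (-(α + 1 / 2))) x‖ := by
    filter_upwards [ae_besselMeasure_pos α] with x hx
    by_cases hxS : x ∈ S
    · simpa [κ, hxS, abs_of_pos (Real.rpow_pos_of_pos hx _)] using hC x y hx hy
    · simp [κ, hxS]
  have hmem : MemLp κ 2 (besselMeasure α) :=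
    hρ.of_le_mul ((Complex.measurable_ofReal.comp hj.measurable).indicator hS).aestronglyMeasurable
      hκ
  refine ⟨hmem.toLp κ, ?_, fun f hf => ?_⟩
  · rw [mul_right_comm]
    refine Lp.norm_le_mul_norm_of_ae_le_mul ?_
    filter_upwards [hκ, hmem.coeFn_toLp, hρ.coeFn_toLp] with x hx hκx hρx
    rwa [hκx, hρx]
  · rw [L2.inner_def, fourierBessel]
    refine integral_congr_ae ?_
    filter_upwards [hmem.coeFn_toLp, (mem_vanishOutside hS).1 hf] with x hx hfx
    by_cases hxS : x ∈ S
    · simp [hx, κ, hxS]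
    · simp [hfx hxS]

theorem isCompactOperator_localization_fourierBesselL2 (hα : -1 / 2 ≤ α) (hS : MeasurableSet S)
    (hSf : volume S < ⊤) (hT : MeasurableSet T) (hTf : volume T < ⊤) :
    IsCompactOperator (localization (fourierBesselL2 (neg_one_lt_of_neg_half_le hα))
      (vanishOutside ℂ (besselMeasure α) S) (vanishOutside ℂ (besselMeasure α) T)) := by
  have : Fact ((2 : ENNReal) ≠ ⊤) := ⟨by simp⟩
  obtain ⟨B, hB⟩ := exists_fourierBessel_eq_inner hα hS hSf
  choose! k hk hkf using hB
  have hG : MemLp (T.indicator fun y => B * y ^ (-(α + 1 / 2))) 2 (besselMeasure α) := by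
    convert (memLp_indicator_rpow α hT hTf).const_mul B using 1
    exact funext fun y => Set.indicator_const_mul T _ B y
  refine isCompactOperator_localization_vanishOutside hT hG
    ((ae_besselMeasure_pos α).mono hk) fun f hf => ?_
  filter_upwards [fourierBesselL2_ae_eq_of_mem_vanishOutside hα hS hSf hf,
    ae_besselMeasure_pos α] with y hy hpos
  rw [hy, hkf y hpos f hf]

end Compactness

/-! ### Dilations -/

section Dilation

variable {α c : ℝ}

theorem quasiMeasurePreserving_mul_left_besselMeasure (α : ℝ) (hc : 0 < c) :
    Measure.QuasiMeasurePreserving (c * ·) (besselMeasure α) (besselMeasure α) :=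
  ⟨measurable_const_mul c, map_mul_left_besselMeasure α hc ▸ Measure.smul_absolutelyContinuous⟩

theorem fourierBessel_comp_mul_left (hc : 0 < c) (f : ℝ → ℂ) (y : ℝ) :
    fourierBessel α (fun x => f (c * x)) y =
      ((c ^ (-(2 * α + 2)) : ℝ) : ℂ) * fourierBessel α f (c⁻¹ * y) := by
  have hmap := (measurableEmbedding_mulLeft₀ hc.ne').integral_map (μ := besselMeasure α)
    fun x => f x * (besselj α (2 * Real.pi * x * (c⁻¹ * y)) : ℂ)
  rw [map_mul_left_besselMeasure α hc, integral_smul_measure,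
    ENNReal.toReal_ofReal (by positivity), Complex.real_smul] at hmap
  rw [fourierBessel, fourierBessel, hmap]
  congr! 5 with x
  field_simp

theorem memLp_comp_mul_left (hc : 0 < c) (f : L2Bessel α) :
    MemLp (fun x => f (c * x)) 2 (besselMeasure α) :=
  MemLp.comp_of_map (g := f)
    (map_mul_left_besselMeasure α hc ▸ (Lp.memLp f).smul_measure ENNReal.ofReal_ne_top)
    (measurable_const_mul c).aemeasurable

/-- The dilate `x ↦ f (c x)` of `f ∈ L²_α` by a factor `c > 0`. -/
noncomputable def dilate (hc : 0 < c) (f : L2Bessel α) : L2Bessel α :=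
  (memLp_comp_mul_left hc f).toLp _

theorem dilate_ae_eq (hc : 0 < c) (f : L2Bessel α) :
    dilate hc f =ᵐ[besselMeasure α] fun x => f (c * x) :=
  (memLp_comp_mul_left hc f).coeFn_toLp

theorem dilate_mem_vanishOutside (hc : 0 < c) {S : Set ℝ} (hS : MeasurableSet S)
    {f : L2Bessel α} (hf : f ∈ vanishOutside ℂ (besselMeasure α) S) :
    dilate hc f ∈ vanishOutside ℂ (besselMeasure α) ((c * ·) ⁻¹' S) := by
  rw [mem_vanishOutside (measurable_const_mul c hS)]
  filter_upwards [dilate_ae_eq hc f, (quasiMeasurePreserving_mul_left_besselMeasure α hc).ae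
    ((mem_vanishOutside hS).1 hf)] with x hdilate hx hxS
  rw [hdilate, hx hxS]

theorem fourierBesselL2_dilate_mem_vanishOutside (hα : -1 / 2 ≤ α) (hc : 0 < c) {S T : Set ℝ}
    (hS : MeasurableSet S) (hSf : volume S < ⊤) (hT : MeasurableSet T) {f : L2Bessel α}
    (hf : f ∈ vanishOutside ℂ (besselMeasure α) S)
    (hFf : fourierBesselL2 (neg_one_lt_of_neg_half_le hα) f ∈
      vanishOutside ℂ (besselMeasure α) T) :
    fourierBesselL2 (neg_one_lt_of_neg_half_le hα) (dilate hc f) ∈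
      vanishOutside ℂ (besselMeasure α) ((c⁻¹ * ·) ⁻¹' T) := by
  have hSc : volume ((c * ·) ⁻¹' S) < ⊤ := by
    rw [Real.volume_preimage_mul_left hc.ne']
    exact ENNReal.mul_lt_top ENNReal.ofReal_lt_top hSf
  have hFf₀ : ∀ᵐ y ∂(besselMeasure α), y ∉ T → fourierBessel α f y = 0 := by
    filter_upwards [fourierBesselL2_ae_eq_of_mem_vanishOutside hα hS hSf hf,
      (mem_vanishOutside hT).1 hFf] with y hy hyT hyn
    rw [← hy, hyT hyn]
  rw [mem_vanishOutside (measurable_const_mul c⁻¹ hT)]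
  filter_upwards [fourierBesselL2_ae_eq_of_mem_vanishOutside hα (measurable_const_mul c hS) hSc
      (dilate_mem_vanishOutside hc hS hf),
    (quasiMeasurePreserving_mul_left_besselMeasure α (inv_pos.2 hc)).ae hFf₀] with y hy hyT hyn
  have hcongr : fourierBessel α (dilate hc f) y = fourierBessel α (fun x => f (c * x)) y :=
    integral_congr_ae ((dilate_ae_eq hc f).mul (.refl _ _))
  rw [hy, hcongr, fourierBessel_comp_mul_left hc, hyT hyn, mul_zero]

end Dilation

theorem eventually_forall_inv_mul_mem {K U : Set ℝ} (hK : IsCompact K) (hU : IsOpen U)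
    (hKU : K ⊆ U) : ∀ᶠ c : ℝ in 𝓝 1, ∀ x ∈ K, c⁻¹ * x ∈ U := by
  refine hK.eventually_forall_of_forall_eventually fun x hx => ?_
  have hcont : ContinuousAt (fun z : ℝ × ℝ => z.1⁻¹ * z.2) (1, x) :=
    (continuousAt_fst.inv₀ (by simp)).mul continuousAt_snd
  exact hcont.eventually_mem (hU.mem_nhds (by simpa using hKU hx))

theorem tendsto_volume_preimage_mul_diff {S : Set ℝ} (hS : MeasurableSet S)
    (hSf : volume S < ⊤) :
    Tendsto (fun c : ℝ => volume ((c * ·) ⁻¹' S \ S)) (𝓝 1) (𝓝 0) := by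
  refine ENNReal.tendsto_nhds_zero.2 fun ε hε => ?_
  have hε3 : ε / 3 ≠ 0 := (ENNReal.div_pos hε.ne' (by simp)).ne'
  obtain ⟨K, hKS, hK, hSK⟩ := hS.exists_isCompact_sdiff_lt hSf.ne hε3
  obtain ⟨U, hKU, hU, -, hUK⟩ := hK.measurableSet.exists_isOpen_sdiff_lt
    (hK.measure_lt_top (μ := volume)).ne hε3
  filter_upwards [eventually_forall_inv_mul_mem hK hU hKU,
    lt_mem_nhds (show (1 / 2 : ℝ) < 1 by norm_num)] with c hcU hc
  have hc0 : 0 < c := by linarith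
  have hsub : (c * ·) ⁻¹' S \ S ⊆ (c * ·) ⁻¹' (S \ K) ∪ U \ K := by
    rintro x ⟨hcx, hx⟩
    by_cases hxK : c * x ∈ K
    · exact Or.inr ⟨by simpa [hc0.ne'] using hcU _ hxK, fun h => hx (hKS h)⟩
    · exact Or.inl ⟨hcx, hxK⟩
  have hinv : ENNReal.ofReal |c⁻¹| ≤ 2 := by
    rw [abs_of_pos (inv_pos.2 hc0)]
    exact ENNReal.ofReal_le_ofNat.2 ((inv_le_comm₀ hc0 two_pos).2 (by linarith))
  calc volume ((c * ·) ⁻¹' S \ S)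
      ≤ volume ((c * ·) ⁻¹' (S \ K)) + volume (U \ K) :=
        (measure_mono hsub).trans (measure_union_le _ _)
    _ ≤ 2 * (ε / 3) + ε / 3 := by
        rw [Real.volume_preimage_mul_left hc0.ne']
        gcongr
    _ = ε := by
        rw [← add_one_mul, show (2 : ENNReal) + 1 = 3 by norm_num,
          ENNReal.mul_div_cancel (by simp) (by simp)]

theorem exists_seq_tsum_volume_preimage_mul_diff_ne_top {S T : Set ℝ} (hS : MeasurableSet S)
    (hSf : volume S < ⊤) (hT : MeasurableSet T) (hTf : volume T < ⊤) :
    ∃ c : ℕ → ℝ, (∀ n, 0 < c n) ∧ (∀ n, c n < 1) ∧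
      ∑' n, volume ((c n * ·) ⁻¹' S \ S) ≠ ⊤ ∧ ∑' n, volume (((c n)⁻¹ * ·) ⁻¹' T \ T) ≠ ⊤ := by
  obtain ⟨δ, hδ0, hδ⟩ := ENNReal.exists_pos_sum_of_countable' (one_ne_zero (α := ENNReal)) ℕ
  have hδtop : ∑' n, δ n ≠ ⊤ := (hδ.trans ENNReal.one_lt_top).ne
  have hinv : Tendsto (fun c : ℝ => c⁻¹) (𝓝 1) (𝓝 1) := by
    simpa using tendsto_inv₀ (one_ne_zero (α := ℝ))
  have hclose : ∀ n, ∃ c : ℝ, c < 1 ∧ 0 < c ∧ volume ((c * ·) ⁻¹' S \ S) ≤ δ n ∧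
      volume ((c⁻¹ * ·) ⁻¹' T \ T) ≤ δ n := fun n =>
    (eventually_mem_nhdsWithin.and (nhdsWithin_le_nhds ((lt_mem_nhds zero_lt_one).and
      ((ENNReal.tendsto_nhds_zero.1 (tendsto_volume_preimage_mul_diff hS hSf) _ (hδ0 n)).and
        (hinv.eventually (ENNReal.tendsto_nhds_zero.1
          (tendsto_volume_preimage_mul_diff hT hTf) _ (hδ0 n))))))).exists (f := 𝓝[<] 1)
  choose c hc1 hc0 hcS hcT using hclose
  exact ⟨c, hc0, hc1, ne_top_of_le_ne_top hδtop (ENNReal.tsum_le_tsum hcS),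
    ne_top_of_le_ne_top hδtop (ENNReal.tsum_le_tsum hcT)⟩

/-! ### Weak annihilation -/

theorem exists_forall_le_of_antitone {K M : Type*} [DivisionRing K] [AddCommGroup M] [Module K M]
    {V : ℕ → Submodule K M} (hV : Antitone V) [FiniteDimensional K (V 0)] :
    ∃ N, ∀ m, V N ≤ V m := by
  let N := Function.argmin fun n => Module.finrank K (V n)
  have : FiniteDimensional K (V N) := Submodule.finiteDimensional_of_le (hV (Nat.zero_le N))
  refine ⟨N, fun m => ?_⟩
  have heq : V (max N m) = V N := Submodule.eq_of_le_of_finrank_le (hV (le_max_left N m))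
    (Function.argmin_le (fun n => Module.finrank K (V n)) _)
  exact heq ▸ hV (le_max_right N m)

section BorelCantelli

variable {X : Type*} [MeasurableSpace X] {S : Set X} {D : ℕ → Set X}

theorem measure_iUnion_lt_top_of_tsum_measure_sdiff_ne_top {μ : Measure X} (hS : μ S < ⊤)
    (hD : ∑' n, μ (D n \ S) ≠ ⊤) : μ (⋃ n, D n) < ⊤ := by
  have hsub : ⋃ n, D n ⊆ S ∪ ⋃ n, D n \ S := by
    rw [← Set.iUnion_sdiff, Set.union_sdiff_self]
    exact Set.subset_union_right
  exact (measure_mono hsub).trans_lt <| measure_union_lt_top hS <|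
    (measure_iUnion_le _).trans_lt hD.lt_top

theorem mem_vanishOutside_of_forall_mem_vanishOutside_iUnion {𝕜 : Type*} [RCLike 𝕜]
    {μ ν : Measure X} (hμν : μ ≪ ν) (hS : MeasurableSet S) (hD : ∀ n, MeasurableSet (D n))
    (hDS : ∑' n, ν (D n \ S) ≠ ⊤) {g : Lp 𝕜 2 μ}
    (hg : ∀ N, g ∈ vanishOutside 𝕜 μ (⋃ n ≥ N, D n)) : g ∈ vanishOutside 𝕜 μ S := by
  have hvanish : ∀ᵐ x ∂μ, ∀ N, x ∉ ⋃ n ≥ N, D n → g x = 0 := ae_all_iff.2 fun N =>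
    (mem_vanishOutside (.biUnion (Set.to_countable _) fun n _ => hD n)).1 (hg N)
  rw [mem_vanishOutside hS]
  filter_upwards [hvanish, hμν.ae_le (ae_eventually_notMem hDS)] with x hx hxD hxS
  obtain ⟨N, hN⟩ := eventually_atTop.1 hxD
  refine hx N fun hmem => ?_
  obtain ⟨n, hn, hxn⟩ := Set.mem_iUnion₂.1 hmem
  exact hN n hn ⟨hxn, hxS⟩

end BorelCantelli

section PosSupport

variable {α : ℝ} {f : L2Bessel α}

/-- The support of (the chosen representative of) `f ∈ L²_α` in the open half-line. -/
def posSupport (f : L2Bessel α) : Set ℝ := {x | 0 < x ∧ f x ≠ 0}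

theorem measurableSet_posSupport (f : L2Bessel α) : MeasurableSet (posSupport f) :=
  measurableSet_Ioi.inter (measurableSet_support (Lp.stronglyMeasurable f).measurable)

theorem mem_vanishOutside_posSupport (f : L2Bessel α) :
    f ∈ vanishOutside ℂ (besselMeasure α) (posSupport f) := by
  rw [mem_vanishOutside (measurableSet_posSupport f)]
  filter_upwards [ae_besselMeasure_pos α] with x hx hxf
  exact by_contra fun hne => hxf ⟨hx, hne⟩

theorem volume_posSupport_le {S : Set ℝ} (hS : MeasurableSet S)
    (hf : f ∈ vanishOutside ℂ (besselMeasure α) S) : volume (posSupport f) ≤ volume S := by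
  refine measure_mono_ae ?_
  filter_upwards [(ae_besselMeasure_iff α).1 ((mem_vanishOutside hS).1 hf)] with x hx hxf
  exact by_contra fun hxS => hxf.2 (hx hxf.1 hxS)

theorem eq_zero_of_volume_posSupport_eq_zero (hf : volume (posSupport f) = 0) : f = 0 := by
  rw [Lp.eq_zero_iff_ae_eq_zero]
  refine (ae_besselMeasure_iff α).2 ?_
  filter_upwards [measure_eq_zero_iff_ae_notMem.1 hf] with x hx hpos
  exact by_contra fun hne => hx ⟨hpos, hne⟩

theorem eq_zero_of_dilate_mem_vanishOutside_posSupport {c : ℝ} (hc : 0 < c) (hc1 : c < 1)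
    (hf : volume (posSupport f) < ⊤)
    (h : dilate hc f ∈ vanishOutside ℂ (besselMeasure α) (posSupport f)) : f = 0 := by
  have hvanish : ∀ᵐ x ∂(besselMeasure α), x ∉ posSupport f → f (c * x) = 0 := by
    filter_upwards [(mem_vanishOutside (measurableSet_posSupport f)).1 h, dilate_ae_eq hc f]
      with x hx hdilate hxf
    rw [← hdilate, hx hxf]
  have hle : volume ((c * ·) ⁻¹' posSupport f) ≤ volume (posSupport f) := by
    refine measure_mono_ae ?_
    filter_upwards [(ae_besselMeasure_iff α).1 hvanish] with x hx hcx
    exact by_contra fun hxf => hcx.2 (hx (pos_of_mul_pos_right hcx.1 hc.le) hxf)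
  rw [Real.volume_preimage_mul_left hc.ne', abs_of_pos (inv_pos.2 hc)] at hle
  have hinv : 1 < ENNReal.ofReal c⁻¹ := ENNReal.one_lt_ofReal.2 ((one_lt_inv₀ hc).2 hc1)
  refine eq_zero_of_volume_posSupport_eq_zero (by_contra fun hne => hle.not_gt ?_)
  simpa only [one_mul] using ENNReal.mul_lt_mul_left hne hf.ne hinv

end PosSupport

theorem besselMeasure_absolutelyContinuous (α : ℝ) : besselMeasure α ≪ volume :=
  (withDensity_absolutelyContinuous _ _).trans Measure.restrict_le_self.absolutelyContinuous

section Bivanishing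

variable {α : ℝ} {F : L2Bessel α →ₗᵢ[ℂ] L2Bessel α} {S S' T T' : Set ℝ}

/-- The subspace of all `f ∈ L²_α` that vanish outside `S` and whose image `F f` vanishes
outside `T`. -/
noncomputable def bivanishing (F : L2Bessel α →ₗᵢ[ℂ] L2Bessel α) (S T : Set ℝ) :
    Submodule ℂ (L2Bessel α) :=
  vanishOutside ℂ (besselMeasure α) S ⊓
    (vanishOutside ℂ (besselMeasure α) T).comap F.toLinearMap

theorem mem_bivanishing {f : L2Bessel α} :
    f ∈ bivanishing F S T ↔ f ∈ vanishOutside ℂ (besselMeasure α) S ∧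
      F f ∈ vanishOutside ℂ (besselMeasure α) T := by
  rw [bivanishing, Submodule.mem_inf, Submodule.mem_comap, LinearIsometry.coe_toLinearMap]

theorem bivanishing_mono (hS : MeasurableSet S) (hS' : MeasurableSet S') (hSS' : S ⊆ S')
    (hT : MeasurableSet T) (hT' : MeasurableSet T') (hTT' : T ⊆ T') :
    bivanishing F S T ≤ bivanishing F S' T' :=
  inf_le_inf (vanishOutside_mono hS hS' hSS')
    (Submodule.comap_mono (vanishOutside_mono hT hT' hTT'))

variable (hα : -1 / 2 ≤ α)

theorem finiteDimensional_bivanishing (hS : MeasurableSet S) (hSf : volume S < ⊤)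
    (hT : MeasurableSet T) (hTf : volume T < ⊤) :
    FiniteDimensional ℂ
      (bivanishing (fourierBesselL2 (neg_one_lt_of_neg_half_le hα)) S T) :=
  finiteDimensional_inf_comap_of_isCompactOperator_localization
    (isCompactOperator_localization_fourierBesselL2 hα hS hSf hT hTf)

theorem dilate_mem_bivanishing {c : ℝ} (hc : 0 < c) (hS : MeasurableSet S)
    (hSf : volume S < ⊤) (hT : MeasurableSet T) {f : L2Bessel α}
    (hf : f ∈ bivanishing (fourierBesselL2 (neg_one_lt_of_neg_half_le hα)) S T) :
    dilate hc f ∈ bivanishing (fourierBesselL2 (neg_one_lt_of_neg_half_le hα))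
      ((c * ·) ⁻¹' S) ((c⁻¹ * ·) ⁻¹' T) :=
  have ⟨hfS, hfT⟩ := mem_bivanishing.1 hf
  mem_bivanishing.2 ⟨dilate_mem_vanishOutside hc hS hfS,
    fourierBesselL2_dilate_mem_vanishOutside hα hc hS hSf hT hfS hfT⟩

theorem exists_dilate_mem_vanishOutside (hS : MeasurableSet S) (hSf : volume S < ⊤)
    (hT : MeasurableSet T) (hTf : volume T < ⊤) {f : L2Bessel α}
    (hf : f ∈ bivanishing (fourierBesselL2 (neg_one_lt_of_neg_half_le hα)) S T) :
    ∃ (c : ℝ) (hc : 0 < c), c < 1 ∧ dilate hc f ∈ vanishOutside ℂ (besselMeasure α) S := by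
  obtain ⟨c, hc0, hc1, hcS, hcT⟩ := exists_seq_tsum_volume_preimage_mul_diff_ne_top hS hSf hT hTf
  let D (N : ℕ) : Set ℝ := ⋃ n ≥ N, (c n * ·) ⁻¹' S
  let T' : Set ℝ := ⋃ n, ((c n)⁻¹ * ·) ⁻¹' T
  have hSmeas (n : ℕ) : MeasurableSet ((c n * ·) ⁻¹' S) := measurable_const_mul (c n) hS
  have hTmeas (n : ℕ) : MeasurableSet (((c n)⁻¹ * ·) ⁻¹' T) := measurable_const_mul (c n)⁻¹ hT
  have hDmeas (N : ℕ) : MeasurableSet (D N) := .biUnion (Set.to_countable _) fun n _ => hSmeas n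
  have hT'meas : MeasurableSet T' := .iUnion hTmeas
  let V (N : ℕ) := bivanishing (fourierBesselL2 (neg_one_lt_of_neg_half_le hα)) (D N) T'
  have hV : Antitone V := fun N M hNM => bivanishing_mono (hDmeas M) (hDmeas N)
    (Set.biUnion_subset_biUnion_left fun n (hn : M ≤ n) => hNM.trans hn) hT'meas hT'meas subset_rfl
  have hdilate (n : ℕ) : dilate (hc0 n) f ∈ V n :=
    bivanishing_mono (hSmeas n) (hDmeas n) (Set.subset_iUnion₂_of_subset n le_rfl subset_rfl)
      (hTmeas n) hT'meas (Set.subset_iUnion_of_subset n subset_rfl)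
      (dilate_mem_bivanishing hα (hc0 n) hS hSf hT hf)
  have hDfin : volume (D 0) < ⊤ := by
    simpa [D] using measure_iUnion_lt_top_of_tsum_measure_sdiff_ne_top hSf hcS
  have : FiniteDimensional ℂ (V 0) := finiteDimensional_bivanishing hα (hDmeas 0) hDfin hT'meas
    (measure_iUnion_lt_top_of_tsum_measure_sdiff_ne_top hTf hcT)
  obtain ⟨N, hN⟩ := exists_forall_le_of_antitone hV
  exact ⟨c N, hc0 N, hc1 N, mem_vanishOutside_of_forall_mem_vanishOutside_iUnion
    (besselMeasure_absolutelyContinuous α) hS hSmeas hcS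
    fun m => (mem_bivanishing.1 (hN m (hdilate N))).1⟩

theorem bivanishing_fourierBesselL2_eq_bot (hS : MeasurableSet S) (hSf : volume S < ⊤)
    (hT : MeasurableSet T) (hTf : volume T < ⊤) :
    bivanishing (fourierBesselL2 (neg_one_lt_of_neg_half_le hα)) S T = ⊥ := by
  refine (Submodule.eq_bot_iff _).2 fun f hf => ?_
  have ⟨hfS, hFf⟩ := mem_bivanishing.1 hf
  have hfin : volume (posSupport f) < ⊤ := (volume_posSupport_le hS hfS).trans_lt hSf
  obtain ⟨c, hc, hc1, hmem⟩ := exists_dilate_mem_vanishOutside hα (measurableSet_posSupport f)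
    hfin hT hTf (mem_bivanishing.2 ⟨mem_vanishOutside_posSupport f, hFf⟩)
  exact eq_zero_of_dilate_mem_vanishOutside_posSupport hc hc1 hfin hmem

end Bivanishing

/-! ### Strong annihilation -/

theorem normOn_Ici_diff {α : ℝ} {A : Set ℝ} (hA : MeasurableSet A) (f : L2Bessel α) :
    normOn α (Set.Ici 0 \ A) f =
      ‖f - (vanishOutside ℂ (besselMeasure α) A).starProjection f‖ := by
  have hset : (Set.Ici 0 \ A : Set ℝ) =ᵐ[besselMeasure α] (Aᶜ : Set ℝ) := by
    filter_upwards [ae_besselMeasure_pos α] with x hx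
    exact propext (and_iff_right (Set.mem_Ici.2 hx.le))
  rw [norm_sub_starProjection_vanishOutside hA, normOn, Measure.restrict_congr_set hset]

theorem volume_lt_top_of_besselMeasure_lt_top {α : ℝ} (hα : -1 / 2 ≤ α) {S : Set ℝ}
    (hS : MeasurableSet S) (hS0 : S ⊆ Set.Ici 0) (h : besselMeasure α S < ⊤) :
    volume S < ⊤ := by
  have hfar : volume (S ∩ Set.Ici 1) < ⊤ := by
    have hweight : ∀ x ∈ S ∩ Set.Ici 1, (2 * Real.pi) ^ (α + 1) ≤ besselWeight α x := fun x hx =>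
      le_mul_of_one_le_right (by positivity) (Real.one_le_rpow hx.2 (by linarith))
    have hle : ENNReal.ofReal ((2 * Real.pi) ^ (α + 1)) * volume (S ∩ Set.Ici 1) ≤
        besselMeasure α S := by
      rw [besselMeasure_eq_withDensity_Ioi, withDensity_apply _ hS,
        Measure.restrict_restrict hS, ← setLIntegral_const]
      exact (setLIntegral_mono' (hS.inter measurableSet_Ici) fun x hx =>
        ENNReal.ofReal_le_ofReal (hweight x hx)).trans <| lintegral_mono_set <|
          Set.inter_subset_inter_right S (Set.Ici_subset_Ioi.2 zero_lt_one)
    exact ENNReal.lt_top_of_mul_ne_top_right (hle.trans_lt h).ne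
      (ENNReal.ofReal_pos.2 (by positivity)).ne'
  have hsub : S ⊆ Set.Icc 0 1 ∪ S ∩ Set.Ici 1 := fun x hx =>
    (le_total x 1).imp (fun hx1 => ⟨hS0 hx, hx1⟩) fun hx1 => ⟨hx, hx1⟩
  exact (measure_mono hsub).trans_lt (measure_union_lt_top measure_Icc_lt_top hfar)

theorem theorem4p3_general {α : ℝ} (hα : -1 / 2 ≤ α) {S T : Set ℝ} (hS : MeasurableSet S)
    (hT : MeasurableSet T) (hSf : volume S < ⊤) (hTf : volume T < ⊤) :
    IsStrongAnnihilatingPair α S T := by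
  obtain ⟨C, -, hC⟩ := exists_norm_le_mul_of_isCompactOperator_localization
    (isCompactOperator_localization_fourierBesselL2 hα hS hSf hT hTf)
    (bivanishing_fourierBesselL2_eq_bot hα hS hSf hT hTf)
  refine ⟨_, isFourierBesselL2_fourierBesselL2 hα, C, fun f => ?_⟩
  rw [normOn_Ici_diff hS, normOn_Ici_diff hT]
  exact hC f

theorem theorem4p3 (α : ℝ) (hα : -1 / 2 < α) (S T : Set ℝ)
    (hS : MeasurableSet S) (hT : MeasurableSet T)
    (hS0 : S ⊆ Set.Ici 0) (hT0 : T ⊆ Set.Ici 0) :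
    (0 < volume S → volume S < ⊤ → 0 < volume T → volume T < ⊤ →
      IsStrongAnnihilatingPair α S T) ∧
    (besselMeasure α S < ⊤ → besselMeasure α T < ⊤ →
      IsStrongAnnihilatingPair α S T) :=
  ⟨fun _ hSf _ hTf => theorem4p3_general hα.le hS hT hSf hTf,
    fun hSf hTf => theorem4p3_general hα.le hS hT
      (volume_lt_top_of_besselMeasure_lt_top hα.le hS hS0 hSf)
      (volume_lt_top_of_besselMeasure_lt_top hα.le hT hT0 hTf)⟩
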